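/- Let $d\ge 2$. For a bounded nonempty open set $\Omega\subset\mathbb R^d$ let $|\Omega|$ be its Lebesgue measure and $|\partial\Omega|$ the $(d-1)$-dimensional Hausdorff measure of its boundary (normalised to agree with Lebesgue measure on $\mathbb R^{d-1}$). Let $\omega_h=\{x\in\Omega:\operatorname{dist}(x,\partial\Omega)\le h\}$ for $h>0$, and let $r_\Omega=\max_{x\in\Omega}\operatorname{dist}(x,\partial\Omega)$ be the inradius. Let $\mathcal S$ be the class of those $\Omega$ with $|\partial\Omega|<\infty$ and $\lim_{h\to0^+}|\omega_h|/h=|\partial\Omega|$. Let $\Omega\in\mathcal S$. Then $L^2(\Omega)$ has an orthonormal basis $(u_j)_{j\ge1}$ of eigenfunctions of the Dirichlet Laplacian $-\Delta$ on $\Omega$ (the self-adjoint operator of the quadratic form $\int_\Omega|\nabla u|^2$ on $H^1_0(\Omega)$). Let $(\lambda_j)_{j\ge1}$ be the eigenvalues of any such basis, that is, the Dirichlet eigenvalues of $\Omega$ repeated according to multiplicity. For all $0<t\le r_\Omega^2$ the series $\sum_j e^{-\lambda_jt}$ converges and $$\sum_{j=1}^\infty e^{-\lambda_jt}\;\ge\;\frac{|\Omega|}{(4\pi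 t)^{d/2}}-\frac{2\,|\partial\Omega|\,t^{1/2}}{(4\pi t)^{d/2}}+R(t),\qquad R(t):=2\,\frac{t^{1/2}|\partial\Omega|-|\omega_{t^{1/2}}|}{(4\pi t)^{d/2}},$$ and $R(t)=o\bigl(t^{(1-d)/2}\bigr)$ as $t\to0^+$. -/

import Mathlib

open MeasureTheory Filter Topology Asymptotics
open scoped ContDiff

namespace DirichletHeat

noncomputable section

/-- Euclidean space `ℝ^d`. -/
abbrev Space (d : ℕ) : Type := EuclideanSpace ℝ (Fin d)

/-! ### Sobolev spaces and the Dirichlet Laplacian -/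

/-- `φ ∈ C_c^∞(Ω)`. -/
structure IsTestFunction {d : ℕ} (Ω : Set (Space d)) (φ : Space d → ℝ) : Prop where
  smooth : ContDiff ℝ ∞ φ
  compact_support : HasCompactSupport φ
  support_subset : tsupport φ ⊆ Ω

/-- `u ∈ H¹(Ω)` with weak gradient `G`: both are square integrable on `Ω`, and
`∫_Ω u ∇φ = - ∫_Ω φ G` for all `φ ∈ C_c^∞(Ω)`. -/
structure IsH1 {d : ℕ} (Ω : Set (Space d)) (u : Space d → ℝ) (G : Space d → Space d) :
    Prop where
  memLp : MemLp u 2 (volume.restrict Ω)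
  memLp_grad : MemLp G 2 (volume.restrict Ω)
  integral_eq : ∀ φ : Space d → ℝ, IsTestFunction Ω φ →
    ∫ x in Ω, u x • gradient φ x = - ∫ x in Ω, φ x • G x

/-- `u ∈ H¹₀(Ω)` with weak gradient `G`: `u` is in the closure of `C_c^∞(Ω)` in `H¹(Ω)`. -/
structure IsH10 {d : ℕ} (Ω : Set (Space d)) (u : Space d → ℝ) (G : Space d → Space d) : Prop
    extends IsH1 Ω u G where
  approx : ∃ φ : ℕ → Space d → ℝ, (∀ n, IsTestFunction Ω (φ n)) ∧
    Tendsto (fun n => eLpNorm (fun x => φ n x - u x) 2 (volume.restrict Ω)) atTop (𝓝 0) ∧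
    Tendsto (fun n => eLpNorm (fun x => gradient (φ n) x - G x) 2 (volume.restrict Ω))
      atTop (𝓝 0)

/-- `u` is in the domain of the (nonnegative) Dirichlet Laplacian `-Δ` on `Ω` and `-Δ u = f`.
This is the self-adjoint operator of the quadratic form `∫_Ω |∇u|²` on `H¹₀(Ω)`. -/
def DirichletLaplacianEq {d : ℕ} (Ω : Set (Space d)) (u f : Space d → ℝ) : Prop :=
  MemLp f 2 (volume.restrict Ω) ∧
    ∃ G : Space d → Space d, IsH10 Ω u G ∧
      ∀ (v : Space d → ℝ) (K : Space d → Space d), IsH10 Ω v K →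
        ∫ x in Ω, inner ℝ (G x) (K x) = ∫ x in Ω, f x * v x

/-- `u` is an orthonormal basis of `L²(Ω)` that consists of eigenfunctions of the Dirichlet
Laplacian, with eigenvalues `lam`. Thus `lam` lists the Dirichlet eigenvalues of `Ω`, each one
as often as its multiplicity. -/
def IsDirichletEigenbasis {d : ℕ} (Ω : Set (Space d)) (lam : ℕ → ℝ)
    (u : HilbertBasis ℕ ℝ (Lp ℝ 2 (volume.restrict Ω : Measure (Space d)))) : Prop :=
  ∀ j : ℕ, DirichletLaplacianEq Ω (fun x => u j x) (fun x => lam j * u j x)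

/-! ### Geometry of the domain -/

/-- The inradius, the largest distance of a point of `Ω` to the boundary. -/
def inradius {d : ℕ} (Ω : Set (Space d)) : ℝ :=
  sSup ((fun x => Metric.infDist x (frontier Ω)) '' Ω)

/-- The inner tube `ω_h` of the points of `Ω` at distance at most `h` from the boundary. -/
def tube {d : ℕ} (Ω : Set (Space d)) (h : ℝ) : Set (Space d) :=
  {x ∈ Ω | Metric.infDist x (frontier Ω) ≤ h}

/-- `|∂Ω|`, the `(d-1)`-dimensional Hausdorff measure of the boundary, in the usual
normalisation, which gives the unit cube of `ℝ^(d-1)` measure one. -/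
def boundaryMeasure {d : ℕ} (Ω : Set (Space d)) : ℝ :=
  (μHE[d - 1] : Measure (Space d)).real (frontier Ω)

/-- The class `𝒮` of the bounded nonempty open sets `Ω`, with boundary of finite measure, such
that `|ω_h| / h → |∂Ω|` as `h → 0⁺`. -/
structure ClassS {d : ℕ} (Ω : Set (Space d)) : Prop where
  isOpen : IsOpen Ω
  nonempty : Ω.Nonempty
  bounded : Bornology.IsBounded Ω
  boundary_finite : (μHE[d - 1] : Measure (Space d)) (frontier Ω) ≠ ⊤
  tendsto : Tendsto (fun h : ℝ => volume.real (tube Ω h) / h) (𝓝[>] 0)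
    (𝓝 (boundaryMeasure Ω))

/-- The remainder `R(t) = 2 (t^{1/2} |∂Ω| - |ω_{√t}|) / (4πt)^{d/2}`. -/
def remainder {d : ℕ} (Ω : Set (Space d)) (t : ℝ) : ℝ :=
  2 * ((t ^ (1 / 2 : ℝ) * boundaryMeasure Ω - volume.real (tube Ω (t ^ (1 / 2 : ℝ)))) /
    (4 * Real.pi * t) ^ ((d : ℝ) / 2))

end

end DirichletHeat

open scoped FourierTransform ENNReal

namespace DirichletHeat

/-! ### Plancherel's theorem on `L¹ ∩ L²` -/

/-! The lower bound is a coherent-state argument. Fix a test function `φ` on `Ω` with `|φ| ≤ 1`, put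
`N = ‖φ‖²`, `D = ‖∇φ‖²`, and modulate it to `φ e^{2πi x·ξ}`. Its squared coefficients in an
eigenbasis sum to `N`, and weighted by the eigenvalues they sum to at most its energy `D +
4π²|ξ|²N`. Jensen's inequality for `s ↦ e^{-ts}` bounds the sum weighted by `e^{-tλ_j}` below by `N
e^{-tD/N} e^{-4π²t|ξ|²}`. Now integrate over `ξ`. The `j`-th coefficient is the Fourier transform of
`φ u_j` up to conjugation, so by Plancherel its total mass is `‖φ u_j‖² ≤ 1`; the Gaussian
integrates to `(4πt)^{-d/2}`. Hence the heat trace is at least `(N - tD)/(4πt)^{d/2}`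
(`heatTrace_lower_bound`).

Take for `φ` a smoothed version of `min(1, dist/√t)`. The loss in `N` and the term `tD` each cost at
most the volume of a tube slightly wider than `√t`; in the limit the numerator is `|Ω| - 2|ω_{√t}|`
(`heatTrace_lower_bound_tube`). The boundary terms in the claimed bound cancel to exactly this, and
the size of `R` is a restatement of the limit that defines `𝒮`.

Convergence is the same argument with the roles exchanged (`summable_exp_eigenvalue`): `|û_j|²` is a
probability density in frequency with mean energy `λ_j`, so Jensen bounds `e^{-λ_j t}` above by a
Gaussian average of `|û_j|²`, and `∑ |û_j(ξ)|² ≤ |Ω|` by Bessel.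

An eigenbasis exists because the embedding `J` of `H¹₀(Ω)` into `L²(Ω)` is compact: high frequencies
are controlled by the energy, low ones by finitely many orthogonality conditions. The spectral
theorem applies to `J J†`. The basis is countable by separability, and infinite because the heat
trace bound, proved for any countable index type, blows up as `t → 0`. -/

theorem fourier_toLp_ae_eq {d : ℕ} {f : Space d → ℂ} (hf : Integrable f) (hf2 : MemLp f 2) :
    (𝓕 (hf2.toLp f) : Lp ℂ 2 (volume : Measure (Space d))) =ᵐ[volume] 𝓕 f := by
  have hcont : Continuous (𝓕 f) :=
    VectorFourier.fourierIntegral_continuous Real.continuous_fourierChar continuous_inner hf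
  -- The extension to `L²` agrees with the distributional transform, so moving the transform onto a
  -- test function `G` shows that both versions have the same pairing with `G`.
  have key : ∀ᵐ x, ((𝓕 (hf2.toLp f) : Lp ℂ 2 (volume : Measure (Space d))) x - 𝓕 f x) = 0 := by
    apply ae_eq_zero_of_integral_contDiff_smul_eq_zero
    · exact ((Lp.memLp _).locallyIntegrable (by norm_num)).sub hcont.locallyIntegrable
    · intro g hg hgc
      have hg₁ : HasCompactSupport (Complex.ofRealCLM ∘ g) := hgc.comp_left rfl
      have hg₂ : ContDiff ℝ ∞ (Complex.ofRealCLM ∘ g) := by fun_prop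
      set G := hg₁.toSchwartzMap hg₂
      have h2 := congrArg (fun T => T G) (Lp.fourier_toTemperedDistribution_eq (hf2.toLp f))
      simp only [TemperedDistribution.fourier_apply, Lp.toTemperedDistribution_apply] at h2
      have h3 : ∫ x, (G x) • 𝓕 f x = ∫ x, 𝓕 (G : Space d → ℂ) x • f x := by
        have := VectorFourier.integral_fourierIntegral_smul_eq_flip (L := innerₗ (Space d))
          Real.continuous_fourierChar continuous_inner (μ := volume) (ν := volume)
          G.integrable hf
        rw [flip_innerₗ] at this
        exact this.symm
      have h4 : ∫ x, 𝓕 G x • (hf2.toLp f : Space d → ℂ) x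
          = ∫ x, 𝓕 (G : Space d → ℂ) x • f x := by
        refine integral_congr_ae ?_
        filter_upwards [hf2.coeFn_toLp] with x hx
        rw [hx]; rfl
      have h5 : ∫ x, G x • (𝓕 (hf2.toLp f) : Lp ℂ 2 (volume : Measure (Space d))) x
          = ∫ x, G x • 𝓕 f x := by rw [h3, ← h4, h2]
      have i1 : Integrable fun x => g x • (𝓕 (hf2.toLp f) : Lp ℂ 2 (volume : Measure (Space d))) x :=
        ((Lp.memLp _).locallyIntegrable (by norm_num)).integrable_smul_left_of_hasCompactSupport
          hg.continuous hgc
      have i2 : Integrable fun x => g x • 𝓕 f x :=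
        hcont.locallyIntegrable.integrable_smul_left_of_hasCompactSupport hg.continuous hgc
      simp only [smul_sub]
      rw [integral_sub i1 i2, sub_eq_zero]
      exact h5
  filter_upwards [key] with x hx using sub_eq_zero.mp hx

/-- Plancherel's theorem for functions in `L¹ ∩ L²`. -/
theorem lintegral_enorm_fourier_sq {d : ℕ} {f : Space d → ℂ} (hf : Integrable f)
    (hf2 : MemLp f 2) : ∫⁻ ξ, ‖𝓕 f ξ‖ₑ ^ 2 = ∫⁻ x, ‖f x‖ₑ ^ 2 := by
  have h := congrArg (fun r => ENNReal.ofReal r ^ 2) (Lp.norm_fourier_eq (hf2.toLp f))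
  have conv : ∀ g : Lp ℂ 2 (volume : Measure (Space d)),
      ENNReal.ofReal ‖g‖ ^ 2 = ∫⁻ x, ‖g x‖ₑ ^ 2 := by
    intro g
    rw [Lp.norm_def, ENNReal.ofReal_toReal (Lp.eLpNorm_ne_top g),
      eLpNorm_eq_lintegral_rpow_enorm_toReal (by norm_num) (by norm_num), ← ENNReal.rpow_natCast,
      ← ENNReal.rpow_mul]
    norm_num
  simp only [conv] at h
  have e1 := lintegral_congr_ae ((fourier_toLp_ae_eq hf hf2).fun_comp (fun z => ‖z‖ₑ ^ 2))
  have e2 := lintegral_congr_ae (hf2.coeFn_toLp.fun_comp (fun z => ‖z‖ₑ ^ 2))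
  exact e1.symm.trans (h.trans e2)

/-- The cosine transform over `Ω`. -/
noncomputable def cosCoef {d : ℕ} (Ω : Set (Space d)) (u : Space d → ℝ) (ξ : Space d) : ℝ :=
  ∫ x in Ω, Real.cos (2 * Real.pi * inner ℝ x ξ) * u x

/-- The sine transform over `Ω`. -/
noncomputable def sinCoef {d : ℕ} (Ω : Set (Space d)) (u : Space d → ℝ) (ξ : Space d) : ℝ :=
  ∫ x in Ω, Real.sin (2 * Real.pi * inner ℝ x ξ) * u x

theorem integrable_cos_mul {d : ℕ} {μ : Measure (Space d)} {u : Space d → ℝ}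
    (hu : Integrable u μ) (ξ : Space d) :
    Integrable (fun x => Real.cos (2 * Real.pi * inner ℝ x ξ) * u x) μ :=
  hu.bdd_mul (c := 1) (by fun_prop) (ae_of_all _ fun x => Real.abs_cos_le_one _)

theorem integrable_sin_mul {d : ℕ} {μ : Measure (Space d)} {u : Space d → ℝ}
    (hu : Integrable u μ) (ξ : Space d) :
    Integrable (fun x => Real.sin (2 * Real.pi * inner ℝ x ξ) * u x) μ :=
  hu.bdd_mul (c := 1) (by fun_prop) (ae_of_all _ fun x => Real.abs_sin_le_one _)

/-- The eigenbasis lives in a real `L²` space, so complex exponentials are handled through their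
cosine and sine parts; this is the bridge to the complex transform. -/
theorem fourier_indicator {d : ℕ} {Ω : Set (Space d)} (hΩ : MeasurableSet Ω)
    {u : Space d → ℝ} (hu : IntegrableOn u Ω) (ξ : Space d) :
    𝓕 (fun x => ((Ω.indicator u x : ℝ) : ℂ)) ξ =
      (cosCoef Ω u ξ : ℂ) - (sinCoef Ω u ξ : ℂ) * Complex.I := by
  have e : ∀ x, Complex.exp (↑(-2 * Real.pi * inner ℝ x ξ) * Complex.I)
      • ((Ω.indicator u x : ℝ) : ℂ) = Ω.indicator (fun x =>
        ((Real.cos (2 * Real.pi * inner ℝ x ξ) * u x : ℝ) : ℂ)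
          - ((Real.sin (2 * Real.pi * inner ℝ x ξ) * u x : ℝ) : ℂ) * Complex.I) x := by
    intro x
    by_cases hx : x ∈ Ω
    · simp only [hx, Set.indicator_of_mem]
      rw [Complex.exp_mul_I, smul_eq_mul]
      push_cast
      rw [show (-2 * (Real.pi : ℂ) * (inner ℝ x ξ : ℝ)) = -(2 * Real.pi * (inner ℝ x ξ : ℝ)) by ring,
        Complex.cos_neg, Complex.sin_neg]
      ring
    · simp [hx]
  rw [Real.fourier_eq']
  simp_rw [e]
  have i1 : IntegrableOn (fun x => ((Real.cos (2 * Real.pi * inner ℝ x ξ) * u x : ℝ) : ℂ)) Ω :=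
    Integrable.ofReal (integrable_cos_mul hu ξ)
  have i2 : IntegrableOn (fun x => ((Real.sin (2 * Real.pi * inner ℝ x ξ) * u x : ℝ) : ℂ)
      * Complex.I) Ω := (Integrable.ofReal (integrable_sin_mul hu ξ)).mul_const _
  rw [integral_indicator hΩ, integral_sub i1 i2, integral_mul_const,
    integral_complex_ofReal, integral_complex_ofReal]
  rfl

/-- Plancherel's theorem for the cosine and sine transforms. -/
theorem lintegral_coef_sq {d : ℕ} {Ω : Set (Space d)} (hΩ : MeasurableSet Ω)
    {u : Space d → ℝ} (hu : IntegrableOn u Ω) (hu2 : MemLp u 2 (volume.restrict Ω)) :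
    ∫⁻ ξ, ENNReal.ofReal (cosCoef Ω u ξ ^ 2 + sinCoef Ω u ξ ^ 2)
      = ∫⁻ x in Ω, ENNReal.ofReal (u x ^ 2) := by
  have h := lintegral_enorm_fourier_sq (f := fun x => ((Ω.indicator u x : ℝ) : ℂ))
    (Integrable.ofReal ((integrable_indicator_iff hΩ).2 hu))
    (MemLp.ofReal ((memLp_indicator_iff_restrict hΩ).2 hu2))
  have e1 : ∀ ξ, ‖𝓕 (fun x => ((Ω.indicator u x : ℝ) : ℂ)) ξ‖ₑ ^ 2
      = ENNReal.ofReal (cosCoef Ω u ξ ^ 2 + sinCoef Ω u ξ ^ 2) := by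
    intro ξ
    rw [fourier_indicator hΩ hu, ← ofReal_norm, ← ENNReal.ofReal_pow (norm_nonneg _),
      ← Complex.normSq_eq_norm_sq, Complex.normSq_apply]
    congr 1
    simp
    ring
  have e2 : ∀ x, ‖((Ω.indicator u x : ℝ) : ℂ)‖ₑ ^ 2
      = Ω.indicator (fun x => ENNReal.ofReal (u x ^ 2)) x := by
    intro x
    by_cases hx : x ∈ Ω
    · simp only [hx, Set.indicator_of_mem]
      rw [← ofReal_norm, ← ENNReal.ofReal_pow (norm_nonneg _)]
      simp
    · simp [hx]
  simp_rw [e1, e2] at h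
  rw [h, lintegral_indicator hΩ]

theorem continuous_cosCoef {d : ℕ} {Ω : Set (Space d)} {u : Space d → ℝ}
    (hu : IntegrableOn u Ω) : Continuous (cosCoef Ω u) := by
  refine continuous_of_dominated (bound := fun x => |u x|)
    (fun ξ => (integrable_cos_mul hu ξ).aestronglyMeasurable) (fun ξ => ae_of_all _ fun x => ?_)
    hu.abs (ae_of_all _ fun x => by fun_prop)
  rw [Real.norm_eq_abs, abs_mul]
  exact mul_le_of_le_one_left (abs_nonneg _) (Real.abs_cos_le_one _)

theorem continuous_sinCoef {d : ℕ} {Ω : Set (Space d)} {u : Space d → ℝ}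
    (hu : IntegrableOn u Ω) : Continuous (sinCoef Ω u) := by
  refine continuous_of_dominated (bound := fun x => |u x|)
    (fun ξ => (integrable_sin_mul hu ξ).aestronglyMeasurable) (fun ξ => ae_of_all _ fun x => ?_)
    hu.abs (ae_of_all _ fun x => by fun_prop)
  rw [Real.norm_eq_abs, abs_mul]
  exact mul_le_of_le_one_left (abs_nonneg _) (Real.abs_sin_le_one _)

/-! ### Pairings in `L²` -/

theorem inner_toLp_toLp {α E : Type*} [MeasurableSpace α] {μ : Measure α}
    [NormedAddCommGroup E] [InnerProductSpace ℝ E] {f g : α → E}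
    (hf : MemLp f 2 μ) (hg : MemLp g 2 μ) :
    inner ℝ (hf.toLp f) (hg.toLp g) = ∫ x, inner ℝ (f x) (g x) ∂μ := by
  rw [L2.inner_def]
  refine integral_congr_ae ?_
  filter_upwards [hf.coeFn_toLp, hg.coeFn_toLp] with x h1 h2
  rw [h1, h2]

theorem tendsto_toLp {α E : Type*} [MeasurableSpace α] {μ : Measure α}
    [NormedAddCommGroup E] {f : ℕ → α → E} {g : α → E}
    (hf : ∀ n, MemLp (f n) 2 μ) (hg : MemLp g 2 μ)
    (hlim : Tendsto (fun n => eLpNorm (fun x => f n x - g x) 2 μ) atTop (𝓝 0)) :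
    Tendsto (fun n => (hf n).toLp (f n)) atTop (𝓝 (hg.toLp g)) :=
  (Lp.tendsto_Lp_iff_tendsto_eLpNorm'' f hf g hg).2 hlim

theorem tendsto_integral_inner {α E : Type*} [MeasurableSpace α] {μ : Measure α}
    [NormedAddCommGroup E] [InnerProductSpace ℝ E] {f : ℕ → α → E} {g h : α → E}
    (hf : ∀ n, MemLp (f n) 2 μ) (hg : MemLp g 2 μ) (hh : MemLp h 2 μ)
    (hlim : Tendsto (fun n => eLpNorm (fun x => f n x - g x) 2 μ) atTop (𝓝 0)) :
    Tendsto (fun n => ∫ x, inner ℝ (f n x) (h x) ∂μ) atTop (𝓝 (∫ x, inner ℝ (g x) (h x) ∂μ)) := by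
  simp_rw [← inner_toLp_toLp (hf _) hh, ← inner_toLp_toLp hg hh]
  exact (tendsto_toLp hf hg hlim).inner tendsto_const_nhds

/-! ### Test functions and integration by parts -/

variable {d : ℕ} {Ω : Set (Space d)}

theorem continuous_gradient {ψ : Space d → ℝ} (hψ : ContDiff ℝ ∞ ψ) : Continuous (gradient ψ) :=
  (InnerProductSpace.toDual ℝ (Space d)).symm.continuous.comp (hψ.continuous_fderiv (by simp))

theorem support_gradient_subset {φ : Space d → ℝ} :
    Function.support (gradient φ) ⊆ tsupport φ := by
  intro x hx
  refine support_fderiv_subset ℝ (f := φ) ?_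
  simpa [gradient] using hx

theorem hasCompactSupport_gradient {φ : Space d → ℝ} (hφ : HasCompactSupport φ) :
    HasCompactSupport (gradient φ) :=
  HasCompactSupport.of_support_subset_isCompact hφ support_gradient_subset

theorem gradient_fun_mul {f g : Space d → ℝ} {x : Space d} (hf : DifferentiableAt ℝ f x)
    (hg : DifferentiableAt ℝ g x) :
    gradient (fun y => f y * g y) x = f x • gradient g x + g x • gradient f x := by
  refine ext_inner_right ℝ fun v => ?_
  rw [inner_gradient_left, fderiv_fun_mul hf hg, inner_add_left, inner_smul_left, inner_smul_left,
    inner_gradient_left, inner_gradient_left]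
  simp

namespace IsTestFunction

variable {φ : Space d → ℝ}

theorem memLp (hφ : IsTestFunction Ω φ) (p : ℝ≥0∞) (μ : Measure (Space d))
    [IsFiniteMeasureOnCompacts μ] : MemLp φ p μ :=
  hφ.smooth.continuous.memLp_of_hasCompactSupport hφ.compact_support

theorem memLp_gradient (hφ : IsTestFunction Ω φ) (p : ℝ≥0∞) (μ : Measure (Space d))
    [IsFiniteMeasureOnCompacts μ] : MemLp (gradient φ) p μ :=
  (continuous_gradient hφ.smooth).memLp_of_hasCompactSupport
    (hasCompactSupport_gradient hφ.compact_support)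

theorem eq_zero (hφ : IsTestFunction Ω φ) {x : Space d} (hx : x ∉ Ω) : φ x = 0 :=
  image_eq_zero_of_notMem_tsupport fun h => hx (hφ.support_subset h)

theorem gradient_eq_zero (hφ : IsTestFunction Ω φ) {x : Space d} (hx : x ∉ Ω) :
    gradient φ x = 0 := by
  by_contra h
  exact hx (hφ.support_subset (support_gradient_subset h))

theorem mul (hφ : IsTestFunction Ω φ) {ψ : Space d → ℝ} (hψ : ContDiff ℝ ∞ ψ) :
    IsTestFunction Ω (fun x => φ x * ψ x) where
  smooth := hφ.smooth.mul hψ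
  compact_support := hφ.compact_support.mul_right
  support_subset := (tsupport_mul_subset_left).trans hφ.support_subset

theorem integral_inner_gradient (hφ : IsTestFunction Ω φ) {ψ : Space d → ℝ}
    (hψ : ContDiff ℝ ∞ ψ) (e : Space d) :
    ∫ x in Ω, inner ℝ (gradient φ x) (ψ x • e) = - ∫ x in Ω, φ x * inner ℝ (gradient ψ x) e := by
  rw [setIntegral_eq_integral_of_forall_compl_eq_zero
      (fun x hx => by rw [hφ.gradient_eq_zero hx, inner_zero_left]),
    setIntegral_eq_integral_of_forall_compl_eq_zero
      (fun x hx => by rw [hφ.eq_zero hx, zero_mul])]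
  have hφ1 : Continuous (fderiv ℝ φ) := hφ.smooth.continuous_fderiv (by simp)
  have hψ1 : Continuous (fderiv ℝ ψ) := hψ.continuous_fderiv (by simp)
  have hφ0 := hφ.smooth.continuous
  have hψ0 := hψ.continuous
  have hc : HasCompactSupport (fun x => fderiv ℝ φ x e) :=
    hφ.compact_support.fderiv_apply ℝ e
  have := integral_mul_fderiv_eq_neg_fderiv_mul_of_integrable (μ := volume) (f := ψ) (g := φ)
    (v := e)
    (Continuous.integrable_of_hasCompactSupport (by fun_prop) hφ.compact_support.mul_left)
    (Continuous.integrable_of_hasCompactSupport (by fun_prop) hc.mul_left)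
    (Continuous.integrable_of_hasCompactSupport (by fun_prop) hφ.compact_support.mul_left)
    (fun x _ => hψ.differentiable (by simp) x)
    (fun x _ => hφ.smooth.differentiable (by simp) x)
  simp_rw [inner_smul_right, inner_gradient_left]
  rw [this]
  simp_rw [mul_comm]

theorem isH1 (hφ : IsTestFunction Ω φ) : IsH1 Ω φ (gradient φ) where
  memLp := hφ.memLp _ _
  memLp_grad := hφ.memLp_gradient _ _
  integral_eq ψ hψ := by
    refine ext_inner_left ℝ fun e => ?_
    have i1 : Integrable (fun x => φ x • gradient ψ x) (volume.restrict Ω) :=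
      (hφ.smooth.continuous.smul (continuous_gradient hψ.smooth)).integrable_of_hasCompactSupport
        hφ.compact_support.smul_right
    have i2 : Integrable (fun x => ψ x • gradient φ x) (volume.restrict Ω) :=
      (hψ.smooth.continuous.smul (continuous_gradient hφ.smooth)).integrable_of_hasCompactSupport
        hψ.compact_support.smul_right
    rw [inner_neg_right, ← integral_inner i1, ← integral_inner i2]
    have := hψ.integral_inner_gradient hφ.smooth e
    simp_rw [inner_smul_right, real_inner_comm] at this ⊢
    rw [this]

theorem isH10 (hφ : IsTestFunction Ω φ) : IsH10 Ω φ (gradient φ) where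
  toIsH1 := hφ.isH1
  approx := ⟨fun _ => φ, fun _ => hφ, by simp, by simp⟩

end IsTestFunction

/-- Integration by parts of a function in `H¹₀(Ω)` against a smooth function. -/
theorem IsH10.integral_inner_smul {u : Space d → ℝ} {G : Space d → Space d} (h : IsH10 Ω u G)
    {ψ : Space d → ℝ} (hψ : ContDiff ℝ ∞ ψ) (hψ1 : MemLp ψ 2 (volume.restrict Ω))
    (hψ2 : MemLp (gradient ψ) 2 (volume.restrict Ω)) (e : Space d) :
    ∫ x in Ω, inner ℝ (G x) (ψ x • e) = - ∫ x in Ω, u x * inner ℝ (gradient ψ x) e := by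
  obtain ⟨φ, hφ, h1, h2⟩ := h.approx
  have m1 : MemLp (fun x => ψ x • e) 2 (volume.restrict Ω) :=
    (hψ1.norm.const_mul ‖e‖).mono (hψ1.1.smul_const e)
      (ae_of_all _ fun x => by simp [norm_smul, mul_comm])
  have m2 : MemLp (fun x => (inner ℝ (gradient ψ x) e : ℝ)) 2 (volume.restrict Ω) :=
    hψ2.inner_const e
  -- The identity holds for the approximating test functions, and both sides are continuous in `L²`.
  -- As `φ n` has compact support in `Ω`, no decay of `ψ` at the boundary is needed.
  have t1 := tendsto_integral_inner (fun n => (hφ n).memLp_gradient 2 _) h.memLp_grad m1 h2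
  have t2 := (tendsto_integral_inner (fun n => (hφ n).memLp 2 _) h.memLp m2 h1).neg
  refine tendsto_nhds_unique t1 ?_
  simp only [(hφ _).integral_inner_gradient hψ e]
  simpa [mul_comm] using t2

/-! ### The Fourier transform on `H¹₀` -/

theorem contDiff_cos_inner (ξ : Space d) :
    ContDiff ℝ ∞ (fun x : Space d => Real.cos (2 * Real.pi * inner ℝ x ξ)) :=
  Real.contDiff_cos.comp (contDiff_const.mul (contDiff_id.inner ℝ contDiff_const))

theorem contDiff_sin_inner (ξ : Space d) :
    ContDiff ℝ ∞ (fun x : Space d => Real.sin (2 * Real.pi * inner ℝ x ξ)) :=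
  Real.contDiff_sin.comp (contDiff_const.mul (contDiff_id.inner ℝ contDiff_const))

theorem hasFDerivAt_phase (x ξ : Space d) : HasFDerivAt
    (fun x : Space d => 2 * Real.pi * inner ℝ x ξ) ((2 * Real.pi) • innerSL ℝ ξ) x := by
  have := ((innerSL ℝ ξ).hasFDerivAt (x := x)).const_mul (2 * Real.pi)
  simpa [real_inner_comm] using this

theorem gradient_cos_inner (x ξ : Space d) :
    gradient (fun x : Space d => Real.cos (2 * Real.pi * inner ℝ x ξ)) x
      = (-(2 * Real.pi * Real.sin (2 * Real.pi * inner ℝ x ξ))) • ξ := by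
  refine ext_inner_right ℝ fun v => ?_
  rw [inner_gradient_left, (hasFDerivAt_phase x ξ).cos.fderiv, inner_smul_left]
  simp
  ring

theorem gradient_sin_inner (x ξ : Space d) :
    gradient (fun x : Space d => Real.sin (2 * Real.pi * inner ℝ x ξ)) x
      = (2 * Real.pi * Real.cos (2 * Real.pi * inner ℝ x ξ)) • ξ := by
  refine ext_inner_right ℝ fun v => ?_
  rw [inner_gradient_left, (hasFDerivAt_phase x ξ).sin.fderiv, inner_smul_left]
  simp
  ring

theorem memLp_of_bounded {E : Type*} [NormedAddCommGroup E] {f : Space d → E}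
    (hfin : volume Ω ≠ ⊤) (hf : Continuous f) (C : ℝ) (hC : ∀ x, ‖f x‖ ≤ C) :
    MemLp f 2 (volume.restrict Ω) :=
  have : IsFiniteMeasure (volume.restrict Ω) := ⟨by simpa using hfin.lt_top⟩
  MemLp.of_bound hf.aestronglyMeasurable C (ae_of_all _ hC)

theorem memLp_cos (hfin : volume Ω ≠ ⊤) (ξ : Space d) :
    MemLp (fun x : Space d => Real.cos (2 * Real.pi * inner ℝ x ξ)) 2 (volume.restrict Ω) :=
  memLp_of_bounded hfin (by fun_prop) 1 fun x => Real.abs_cos_le_one _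

theorem memLp_sin (hfin : volume Ω ≠ ⊤) (ξ : Space d) :
    MemLp (fun x : Space d => Real.sin (2 * Real.pi * inner ℝ x ξ)) 2 (volume.restrict Ω) :=
  memLp_of_bounded hfin (by fun_prop) 1 fun x => Real.abs_sin_le_one _

theorem integrableOn_of_memLp (hfin : volume Ω ≠ ⊤) {E : Type*} [NormedAddCommGroup E]
    {f : Space d → E} (hf : MemLp f 2 (volume.restrict Ω)) : IntegrableOn f Ω :=
  have : IsFiniteMeasure (volume.restrict Ω) := ⟨by simpa using hfin.lt_top⟩
  hf.integrable (by norm_num)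

variable {u : Space d → ℝ} {G : Space d → Space d}

/-- One half of the rule that the Fourier transform turns the gradient into multiplication by
`2πiξ`. Membership in `H¹₀` removes the boundary term, although the cosine does not vanish on the
boundary. -/
theorem IsH10.cosCoef_grad (h : IsH10 Ω u G) (hfin : volume Ω ≠ ⊤) (ξ e : Space d) :
    cosCoef Ω (fun x => inner ℝ (G x) e) ξ = 2 * Real.pi * inner ℝ ξ e * sinCoef Ω u ξ := by
  have := h.integral_inner_smul (contDiff_cos_inner ξ) (memLp_cos hfin ξ)
    (by
      rw [funext fun x => gradient_cos_inner x ξ]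
      exact (memLp_of_bounded hfin (by fun_prop) (2 * Real.pi * ‖ξ‖) fun x => by
        rw [norm_smul, norm_neg, norm_mul, Real.norm_of_nonneg (by positivity : 0 ≤ 2 * Real.pi)]
        exact mul_le_mul_of_nonneg_right
          (mul_le_of_le_one_right (by positivity) (Real.abs_sin_le_one _)) (norm_nonneg _))) e
  simp_rw [gradient_cos_inner, inner_smul_right, real_inner_smul_left] at this
  rw [cosCoef, this, sinCoef, ← integral_const_mul, ← integral_neg]
  refine integral_congr_ae (ae_of_all _ fun x => ?_)
  ring

theorem IsH10.sinCoef_grad (h : IsH10 Ω u G) (hfin : volume Ω ≠ ⊤) (ξ e : Space d) :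
    sinCoef Ω (fun x => inner ℝ (G x) e) ξ = - (2 * Real.pi * inner ℝ ξ e * cosCoef Ω u ξ) := by
  have := h.integral_inner_smul (contDiff_sin_inner ξ) (memLp_sin hfin ξ)
    (by
      rw [funext fun x => gradient_sin_inner x ξ]
      exact (memLp_of_bounded hfin (by fun_prop) (2 * Real.pi * ‖ξ‖) fun x => by
        rw [norm_smul, norm_mul, Real.norm_of_nonneg (by positivity : 0 ≤ 2 * Real.pi)]
        exact mul_le_mul_of_nonneg_right
          (mul_le_of_le_one_right (by positivity) (Real.abs_cos_le_one _)) (norm_nonneg _))) e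
  simp_rw [gradient_sin_inner, inner_smul_right, real_inner_smul_left] at this
  rw [sinCoef, this, cosCoef, ← integral_const_mul]
  refine congrArg Neg.neg (integral_congr_ae (ae_of_all _ fun x => ?_))
  ring

/-- Plancherel's theorem for the gradient of a function in `H¹₀(Ω)`. -/
theorem IsH10.lintegral_energy (h : IsH10 Ω u G) (hΩ : MeasurableSet Ω) (hfin : volume Ω ≠ ⊤) :
    ∫⁻ ξ, ENNReal.ofReal (4 * Real.pi ^ 2 * ‖ξ‖ ^ 2 * (cosCoef Ω u ξ ^ 2 + sinCoef Ω u ξ ^ 2))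
      = ∫⁻ x in Ω, ENNReal.ofReal (‖G x‖ ^ 2) := by
  -- Scalar Plancherel is applied to each coordinate of `G`; the factors `⟪ξ, b i⟫²` then add up to
  -- `‖ξ‖²`.
  let b : Fin d → Space d := fun i => EuclideanSpace.basisFun (Fin d) ℝ i
  have hm : ∀ i, MemLp (fun x => (inner ℝ (G x) (b i) : ℝ)) 2 (volume.restrict Ω) :=
    fun i => h.memLp_grad.inner_const (b i)
  have hsq : ∀ y : Space d, ENNReal.ofReal (‖y‖ ^ 2)
      = ∑ i, ENNReal.ofReal ((inner ℝ y (b i) : ℝ) ^ 2) := by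
    intro y
    rw [← ENNReal.ofReal_sum_of_nonneg (fun i _ => sq_nonneg _),
      ← OrthonormalBasis.sum_sq_norm_inner_left (EuclideanSpace.basisFun (Fin d) ℝ) y]
    simp [b]
  have hu := integrableOn_of_memLp hfin h.memLp
  have hcu := continuous_cosCoef hu
  have hsu := continuous_sinCoef hu
  simp_rw [hsq]
  rw [lintegral_finsetSum' _ fun i _ => ((hm i).1.aemeasurable.pow_const 2).ennreal_ofReal]
  simp_rw [← lintegral_coef_sq hΩ (integrableOn_of_memLp hfin (hm _)) (hm _),
    h.cosCoef_grad hfin, h.sinCoef_grad hfin]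
  rw [← lintegral_finsetSum' _ fun i _ => by
    refine (Continuous.measurable ?_).aemeasurable.ennreal_ofReal
    fun_prop]
  refine lintegral_congr fun ξ => ?_
  rw [← ENNReal.ofReal_sum_of_nonneg (fun i _ => by positivity)]
  congr 1
  have : ‖ξ‖ ^ 2 = ∑ i, (inner ℝ ξ (b i) : ℝ) ^ 2 := by
    rw [← OrthonormalBasis.sum_sq_norm_inner_left (EuclideanSpace.basisFun (Fin d) ℝ) ξ]
    simp [b]
  rw [this, Finset.mul_sum, Finset.sum_mul]
  refine Finset.sum_congr rfl fun i _ => ?_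
  ring

/-! ### Bounds for spectral sums -/

/-- The tangent line bound for the convex function `s ↦ e^{-ts}`. -/
theorem exp_tangent_le (t m s : ℝ) :
    Real.exp (-t * m) * (1 - t * (s - m)) ≤ Real.exp (-t * s) := by
  have h := Real.add_one_le_exp (-t * (s - m))
  have e : Real.exp (-t * s) = Real.exp (-t * m) * Real.exp (-t * (s - m)) := by
    rw [← Real.exp_add]; ring_nf
  rw [e]
  exact mul_le_mul_of_nonneg_left (by linarith) (Real.exp_pos _).le

/-- Jensen's inequality for spectral sums. -/
theorem jensen_tsum_exp {ι : Type*} {lam a : ι → ℝ} {N E t : ℝ} (ht : 0 ≤ t)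
    (hlam : ∀ j, 0 ≤ lam j) (ha : ∀ j, 0 ≤ a j) (hN : 0 < N) (hsum : HasSum a N)
    (hE : ∀ F : Finset ι, ∑ j ∈ F, lam j * a j ≤ E) :
    ENNReal.ofReal (N * Real.exp (-t * (E / N)))
      ≤ ∑' j, ENNReal.ofReal (Real.exp (-t * lam j) * a j) := by
  have s1 : Summable fun j => lam j * a j :=
    summable_of_sum_le (fun j => mul_nonneg (hlam j) (ha j)) hE
  have hle : ∑' j, lam j * a j ≤ E := s1.tsum_le_of_sum_le hE
  have s2 : Summable fun j => Real.exp (-t * lam j) * a j :=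
    hsum.summable.of_nonneg_of_le (fun j => mul_nonneg (Real.exp_pos _).le (ha j)) fun j =>
      mul_le_of_le_one_left (ha j) (Real.exp_le_one_iff.2 (by nlinarith [hlam j]))
  rw [← ENNReal.ofReal_tsum_of_nonneg (fun j => mul_nonneg (Real.exp_pos _).le (ha j)) s2]
  refine ENNReal.ofReal_le_ofReal ?_
  -- The tangent is taken at the upper bound `m` for the mean energy. Its slope is negative, so an
  -- upper bound on the mean suffices.
  set m := E / N
  have hmN : m * N = E := div_mul_cancel₀ _ hN.ne'
  have s3 : HasSum (fun j => Real.exp (-t * m) * ((1 + t * m) * a j - t * (lam j * a j)))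
      (Real.exp (-t * m) * ((1 + t * m) * N - t * ∑' j, lam j * a j)) :=
    ((hsum.mul_left _).sub (s1.hasSum.mul_left t)).mul_left _
  have h1 : Real.exp (-t * m) * ((1 + t * m) * N - t * ∑' j, lam j * a j)
      ≤ ∑' j, Real.exp (-t * lam j) * a j := by
    rw [← s3.tsum_eq]
    refine s3.summable.tsum_le_tsum (fun j => ?_) s2
    have := mul_le_mul_of_nonneg_right (exp_tangent_le t m (lam j)) (ha j)
    calc _ = _ := by ring
      _ ≤ _ := this
  refine le_trans ?_ h1
  rw [mul_comm N]
  refine mul_le_mul_of_nonneg_left ?_ (Real.exp_pos _).le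
  nlinarith [mul_le_mul_of_nonneg_left hle ht]

section Eigenbasis

variable {ι : Type*} {lam : ι → ℝ}
  {u : HilbertBasis ι ℝ (Lp ℝ 2 (volume.restrict Ω : Measure (Space d)))}

theorem inner_basis_toLp {v : Space d → ℝ} (hv : MemLp v 2 (volume.restrict Ω)) (j : ι) :
    inner ℝ (u j) (hv.toLp v) = ∫ x in Ω, u j x * v x := by
  have := inner_toLp_toLp (Lp.memLp (u j)) hv
  rw [Lp.toLp_coeFn] at this
  rw [this]
  simp [mul_comm]

/-- The energy form of Bessel's inequality for an eigenbasis. -/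
theorem sum_eigenvalue_mul_le
    (hu : ∀ j, DirichletLaplacianEq Ω (fun x => u j x) (fun x => lam j * u j x))
    {v : Space d → ℝ} {K : Space d → Space d} (hv : IsH10 Ω v K) (F : Finset ι) :
    ∑ j ∈ F, lam j * (∫ x in Ω, u j x * v x) ^ 2 ≤ ∫ x in Ω, ‖K x‖ ^ 2 := by
  classical
  choose hmem G hG hE using hu
  let g : ι → Lp (Space d) 2 (volume.restrict Ω : Measure (Space d)) :=
    fun j => (hG j).memLp_grad.toLp (G j)
  let k : Lp (Space d) 2 (volume.restrict Ω : Measure (Space d)) := hv.memLp_grad.toLp K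
  let c : ι → ℝ := fun j => ∫ x in Ω, u j x * v x
  -- The weak equation makes the gradients of eigenfunctions orthogonal, with squared norms `lam i`.
  have hgg : ∀ i j, inner ℝ (g i) (g j) = if i = j then lam i else 0 := by
    intro i j
    have e : ∫ x in Ω, lam i * u i x * u j x = lam i * inner ℝ (u i) (u j) := by
      rw [L2.inner_def, ← integral_const_mul]
      refine integral_congr_ae (ae_of_all _ fun x => ?_)
      simp only [RCLike.inner_apply, conj_trivial]
      ring
    rw [inner_toLp_toLp, hE i _ _ (hG j), e, orthonormal_iff_ite.1 u.orthonormal i j]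
    simp
  have hgk : ∀ j, inner ℝ (g j) k = lam j * c j := by
    intro j
    rw [inner_toLp_toLp, hE j _ _ hv, ← integral_const_mul]
    simp [mul_assoc]
  have hkk : inner ℝ k k = ∫ x in Ω, ‖K x‖ ^ 2 := by
    rw [inner_toLp_toLp]
    simp
  -- Bessel's inequality by expanding the square. The `g j` are left unnormalised, so no division by
  -- an eigenvalue occurs.
  have h0 := real_inner_self_nonneg (x := k - ∑ j ∈ F, c j • g j)
  have e1 : inner ℝ k (∑ j ∈ F, c j • g j) = ∑ j ∈ F, lam j * c j ^ 2 := by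
    rw [inner_sum]
    refine Finset.sum_congr rfl fun j _ => ?_
    rw [inner_smul_right, real_inner_comm, hgk]
    ring
  have e2 : inner ℝ (∑ j ∈ F, c j • g j) (∑ j ∈ F, c j • g j) = ∑ j ∈ F, lam j * c j ^ 2 := by
    rw [sum_inner]
    refine Finset.sum_congr rfl fun j hj => ?_
    rw [inner_sum, Finset.sum_eq_single j]
    · rw [inner_smul_right, real_inner_smul_left, hgg, if_pos rfl]
      ring
    · intro b _ hb
      rw [inner_smul_right, real_inner_smul_left, hgg, if_neg hb.symm]
      simp
    · exact fun h => absurd hj h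
  rw [inner_sub_left, inner_sub_right, inner_sub_right,
    real_inner_comm k (∑ j ∈ F, c j • g j), e1, e2, hkk] at h0
  linarith

theorem exists_gradient_eigenfunction
    (hu : ∀ j, DirichletLaplacianEq Ω (fun x => u j x) (fun x => lam j * u j x)) (j : ι) :
    ∃ G, IsH10 Ω (fun x => u j x) G ∧ ∫ x in Ω, ‖G x‖ ^ 2 = lam j := by
  obtain ⟨-, G, hG, hE⟩ := hu j
  refine ⟨G, hG, ?_⟩
  have h := hE _ _ hG
  simp only [real_inner_self_eq_norm_sq] at h
  rw [h]
  have e : ∫ x in Ω, lam j * u j x * u j x = lam j * inner ℝ (u j) (u j) := by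
    rw [L2.inner_def, ← integral_const_mul]
    refine integral_congr_ae (ae_of_all _ fun x => ?_)
    simp [mul_assoc, sq]
  rw [e, real_inner_self_eq_norm_sq, u.orthonormal.1 j]
  simp

theorem eigenvalue_nonneg
    (hu : ∀ j, DirichletLaplacianEq Ω (fun x => u j x) (fun x => lam j * u j x)) (j : ι) :
    0 ≤ lam j := by
  obtain ⟨G, -, h⟩ := exists_gradient_eigenfunction hu j
  rw [← h]
  exact integral_nonneg fun x => by positivity

theorem hasSum_sq_integral_basis {v : Space d → ℝ} (hv : MemLp v 2 (volume.restrict Ω)) :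
    HasSum (fun j => (∫ x in Ω, u j x * v x) ^ 2) (∫ x in Ω, v x ^ 2) := by
  have h := u.hasSum_inner_mul_inner (hv.toLp v) (hv.toLp v)
  have e : ∀ j, inner ℝ (hv.toLp v) (u j) * inner ℝ (u j) (hv.toLp v)
      = (∫ x in Ω, u j x * v x) ^ 2 := by
    intro j
    rw [real_inner_comm, inner_basis_toLp hv]
    ring
  simp_rw [e] at h
  rw [inner_toLp_toLp] at h
  simpa [sq] using h

theorem lintegral_sq_basis (j : ι) : ∫⁻ x in Ω, ENNReal.ofReal (u j x ^ 2) = 1 := by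
  have h : ∫ x in Ω, u j x ^ 2 = 1 := by
    have h1 : inner ℝ (u j) (u j) = ∫ x in Ω, u j x ^ 2 := by
      rw [L2.inner_def]
      simp
    rw [← h1, real_inner_self_eq_norm_sq, u.orthonormal.1 j]
    simp
  rw [← ofReal_integral_eq_lintegral_ofReal (Lp.memLp (u j)).integrable_sq
    (ae_of_all _ fun x => sq_nonneg _), h, ENNReal.ofReal_one]

theorem integral_gaussian {t : ℝ} (ht : 0 < t) :
    ∫ ξ : Space d, Real.exp (-t * (4 * Real.pi ^ 2 * ‖ξ‖ ^ 2))
      = ((4 * Real.pi * t) ^ ((d : ℝ) / 2))⁻¹ := by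
  have h := GaussianFourier.integral_rexp_neg_mul_sq_norm (V := Space d)
    (b := 4 * Real.pi ^ 2 * t) (by positivity)
  have e : ∀ ξ : Space d, Real.exp (-t * (4 * Real.pi ^ 2 * ‖ξ‖ ^ 2))
      = Real.exp (-(4 * Real.pi ^ 2 * t) * ‖ξ‖ ^ 2) := fun ξ => by ring_nf
  simp_rw [e, h]
  rw [← Real.inv_rpow (by positivity)]
  congr 1
  · field_simp
  · simp

theorem integrable_gaussian {t : ℝ} (ht : 0 < t) :
    Integrable fun ξ : Space d => Real.exp (-t * (4 * Real.pi ^ 2 * ‖ξ‖ ^ 2)) := by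
  -- The integral of a nonintegrable function is zero by convention, whereas this one has a positive
  -- value.
  by_contra h
  have h1 := integral_undef h
  rw [integral_gaussian ht] at h1
  have : 0 < ((4 * Real.pi * t) ^ ((d : ℝ) / 2))⁻¹ := by positivity
  linarith

/-- A lower bound for the heat trace in terms of a test function bounded by one. -/
theorem heatTrace_lower_bound [Countable ι] (hΩ : MeasurableSet Ω) (hfin : volume Ω ≠ ⊤)
    (hu : ∀ j, DirichletLaplacianEq Ω (fun x => u j x) (fun x => lam j * u j x))
    {φ : Space d → ℝ} (hφ : IsTestFunction Ω φ) (hφ1 : ∀ x, |φ x| ≤ 1) {t : ℝ} (ht : 0 < t) :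
    ENNReal.ofReal (((∫ x in Ω, φ x ^ 2) - t * ∫ x in Ω, ‖gradient φ x‖ ^ 2)
        / (4 * Real.pi * t) ^ ((d : ℝ) / 2))
      ≤ ∑' j, ENNReal.ofReal (Real.exp (-t * lam j)) := by
  set N := ∫ x in Ω, φ x ^ 2
  set D := ∫ x in Ω, ‖gradient φ x‖ ^ 2
  have hD0 : 0 ≤ D := integral_nonneg fun x => by positivity
  have hN0 : 0 ≤ N := integral_nonneg fun x => by positivity
  have hpos : 0 < (4 * Real.pi * t) ^ ((d : ℝ) / 2) := by positivity
  rcases hN0.eq_or_lt with h0 | hNpos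
  · rw [ENNReal.ofReal_of_nonpos]
    · exact zero_le
    · refine div_nonpos_of_nonpos_of_nonneg ?_ hpos.le
      rw [← h0]
      nlinarith
  have hφL := hφ.memLp 2 (volume.restrict Ω)
  have hgL := hφ.memLp_gradient 2 (volume.restrict Ω)
  have iN : Integrable (fun x => φ x ^ 2) (volume.restrict Ω) := hφL.integrable_sq
  have iD : Integrable (fun x => ‖gradient φ x‖ ^ 2) (volume.restrict Ω) := hgL.norm.integrable_sq
  let vc : Space d → Space d → ℝ := fun ξ x => φ x * Real.cos (2 * Real.pi * inner ℝ x ξ)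
  let vs : Space d → Space d → ℝ := fun ξ x => φ x * Real.sin (2 * Real.pi * inner ℝ x ξ)
  have hvc : ∀ ξ, IsTestFunction Ω (vc ξ) := fun ξ => hφ.mul (contDiff_cos_inner ξ)
  have hvs : ∀ ξ, IsTestFunction Ω (vs ξ) := fun ξ => hφ.mul (contDiff_sin_inner ξ)
  let w : ι → Space d → ℝ := fun j x => φ x * u j x
  have hwm : ∀ j, MemLp (w j) 2 (volume.restrict Ω) := fun j =>
    (Lp.memLp (u j)).mono (hφL.1.mul (Lp.memLp (u j)).1) (ae_of_all _ fun x => by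
      simp only [w, norm_mul]
      exact mul_le_of_le_one_left (norm_nonneg _) (hφ1 x))
  have hwi : ∀ j, IntegrableOn (w j) Ω := fun j => integrableOn_of_memLp hfin (hwm j)
  -- `a ξ j` is read in two ways: for fixed `ξ` as the squared coefficients of the modulated `φ` in
  -- the eigenbasis, for fixed `j` as the squared Fourier transform of `φ u_j`.
  let a : Space d → ι → ℝ := fun ξ j => cosCoef Ω (w j) ξ ^ 2 + sinCoef Ω (w j) ξ ^ 2
  have ec : ∀ ξ j, cosCoef Ω (w j) ξ = ∫ x in Ω, u j x * vc ξ x := fun ξ j =>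
    integral_congr_ae (ae_of_all _ fun x => by simp only [w, vc]; ring)
  have es : ∀ ξ j, sinCoef Ω (w j) ξ = ∫ x in Ω, u j x * vs ξ x := fun ξ j =>
    integral_congr_ae (ae_of_all _ fun x => by simp only [w, vs]; ring)
  have hsum : ∀ ξ, HasSum (a ξ) N := by
    intro ξ
    have h1 := hasSum_sq_integral_basis (u := u) ((hvc ξ).memLp 2 (volume.restrict Ω))
    have h2 := hasSum_sq_integral_basis (u := u) ((hvs ξ).memLp 2 (volume.restrict Ω))
    have h3 := h1.add h2
    rw [← integral_add ((hvc ξ).memLp 2 _).integrable_sq ((hvs ξ).memLp 2 _).integrable_sq] at h3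
    convert h3 using 1
    · ext j
      simp only [a, ec, es]
    · refine integral_congr_ae (ae_of_all _ fun x => ?_)
      simp only [vc, vs]
      linear_combination (-φ x ^ 2) * Real.sin_sq_add_cos_sq (2 * Real.pi * inner ℝ x ξ)
  -- The cross terms of the cosine and sine parts have opposite signs and cancel.
  have hgrad : ∀ ξ x, ‖gradient (vc ξ) x‖ ^ 2 + ‖gradient (vs ξ) x‖ ^ 2
      = ‖gradient φ x‖ ^ 2 + 4 * Real.pi ^ 2 * ‖ξ‖ ^ 2 * φ x ^ 2 := by
    intro ξ x
    have dφ := hφ.smooth.differentiable (by simp) x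
    simp only [vc, vs]
    rw [gradient_fun_mul dφ ((contDiff_cos_inner ξ).differentiable (by simp) x),
      gradient_fun_mul dφ ((contDiff_sin_inner ξ).differentiable (by simp) x),
      gradient_cos_inner, gradient_sin_inner]
    simp only [norm_add_sq_real, smul_smul, norm_smul, inner_smul_right, real_inner_smul_left,
      mul_pow, Real.norm_eq_abs, sq_abs, neg_sq]
    linear_combination (‖gradient φ x‖ ^ 2 + 4 * Real.pi ^ 2 * ‖ξ‖ ^ 2 * φ x ^ 2) *
      Real.sin_sq_add_cos_sq (2 * Real.pi * inner ℝ x ξ)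
  have hE : ∀ ξ (F : Finset ι), ∑ j ∈ F, lam j * a ξ j ≤ D + 4 * Real.pi ^ 2 * ‖ξ‖ ^ 2 * N := by
    intro ξ F
    have h1 := sum_eigenvalue_mul_le hu (hvc ξ).isH10 F
    have h2 := sum_eigenvalue_mul_le hu (hvs ξ).isH10 F
    have h3 := add_le_add h1 h2
    rw [← Finset.sum_add_distrib, ← integral_add
      ((hvc ξ).memLp_gradient 2 _).norm.integrable_sq
      ((hvs ξ).memLp_gradient 2 _).norm.integrable_sq] at h3
    simp_rw [hgrad] at h3
    rw [integral_add iD (iN.const_mul _), integral_const_mul] at h3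
    refine le_trans (le_of_eq ?_) h3
    refine Finset.sum_congr rfl fun j _ => ?_
    simp only [a, ec, es]
    ring
  have hcont : ∀ j, Continuous fun ξ => a ξ j := fun j =>
    ((continuous_cosCoef (hwi j)).pow 2).add ((continuous_sinCoef (hwi j)).pow 2)
  have hmass : ∀ j, ∫⁻ ξ, ENNReal.ofReal (a ξ j) ≤ 1 := by
    intro j
    rw [lintegral_coef_sq hΩ (hwi j) (hwm j), ← lintegral_sq_basis (u := u) j]
    refine lintegral_mono fun x => ENNReal.ofReal_le_ofReal ?_
    simp only [w, mul_pow]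
    refine mul_le_of_le_one_left (sq_nonneg _) ?_
    rw [← sq_abs]
    exact pow_le_one₀ (abs_nonneg _) (hφ1 x)
  -- The first step is `1 - tD/N ≤ e^{-tD/N}`. Working with `ENNReal` sums lets sum and integral be
  -- exchanged before summability is known.
  calc ENNReal.ofReal ((N - t * D) / (4 * Real.pi * t) ^ ((d : ℝ) / 2))
      ≤ ENNReal.ofReal (N * Real.exp (-t * (D / N)) *
          ∫ ξ : Space d, Real.exp (-t * (4 * Real.pi ^ 2 * ‖ξ‖ ^ 2))) := by
        refine ENNReal.ofReal_le_ofReal ?_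
        rw [integral_gaussian ht, div_eq_mul_inv]
        refine mul_le_mul_of_nonneg_right ?_ (by positivity)
        have h := mul_le_mul_of_nonneg_left (Real.add_one_le_exp (-t * (D / N))) hNpos.le
        refine le_trans (le_of_eq ?_) h
        field_simp
        ring
    _ = ∫⁻ ξ : Space d, ENNReal.ofReal
          (N * Real.exp (-t * ((D + 4 * Real.pi ^ 2 * ‖ξ‖ ^ 2 * N) / N))) := by
        rw [← integral_const_mul, ofReal_integral_eq_lintegral_ofReal
          ((integrable_gaussian ht).const_mul _) (ae_of_all _ fun ξ => by positivity)]
        refine lintegral_congr fun ξ => ?_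
        rw [mul_assoc, ← Real.exp_add]
        congr 3
        field_simp
        ring
    _ ≤ ∫⁻ ξ : Space d, ∑' j, ENNReal.ofReal (Real.exp (-t * lam j) * a ξ j) :=
        lintegral_mono fun ξ => jensen_tsum_exp ht.le (eigenvalue_nonneg hu)
          (fun j => by positivity) hNpos (hsum ξ) (hE ξ)
    _ = ∑' j, ∫⁻ ξ : Space d, ENNReal.ofReal (Real.exp (-t * lam j) * a ξ j) :=
        lintegral_tsum fun j =>
          (continuous_const.mul (hcont j)).measurable.ennreal_ofReal.aemeasurable
    _ ≤ ∑' j, ENNReal.ofReal (Real.exp (-t * lam j)) := by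
        refine ENNReal.tsum_le_tsum fun j => ?_
        simp_rw [ENNReal.ofReal_mul (Real.exp_pos _).le]
        rw [lintegral_const_mul _ (hcont j).measurable.ennreal_ofReal]
        exact mul_le_of_le_one_right' (hmass j)

end Eigenbasis

/-! ### Finiteness of the heat trace -/

theorem integral_of_lintegral_ofReal {α : Type*} [MeasurableSpace α] {μ : Measure α} {f : α → ℝ}
    (hf : AEStronglyMeasurable f μ) (h0 : ∀ x, 0 ≤ f x) {c : ℝ} (hc : 0 ≤ c)
    (h : ∫⁻ x, ENNReal.ofReal (f x) ∂μ = ENNReal.ofReal c) :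
    Integrable f μ ∧ ∫ x, f x ∂μ = c := by
  refine ⟨⟨hf, ?_⟩, ?_⟩
  · rw [hasFiniteIntegral_iff_ofReal (ae_of_all _ h0), h]
    exact ENNReal.ofReal_lt_top
  · rw [integral_eq_lintegral_of_nonneg_ae (ae_of_all _ h0) hf, h, ENNReal.toReal_ofReal hc]

section Coefficients

variable {v : Space d → ℝ} {K : Space d → Space d}

theorem IsH10.integral_coef (h : IsH10 Ω v K) (hΩ : MeasurableSet Ω) (hfin : volume Ω ≠ ⊤) :
    Integrable (fun ξ => cosCoef Ω v ξ ^ 2 + sinCoef Ω v ξ ^ 2) ∧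
      ∫ ξ, (cosCoef Ω v ξ ^ 2 + sinCoef Ω v ξ ^ 2) = ∫ x in Ω, v x ^ 2 := by
  have hi := integrableOn_of_memLp hfin h.memLp
  have hc := continuous_cosCoef hi
  have hs := continuous_sinCoef hi
  refine integral_of_lintegral_ofReal (Continuous.aestronglyMeasurable (by fun_prop))
    (fun ξ => by positivity) (integral_nonneg fun x => by positivity) ?_
  rw [lintegral_coef_sq hΩ hi h.memLp, ofReal_integral_eq_lintegral_ofReal
    h.memLp.integrable_sq (ae_of_all _ fun x => sq_nonneg _)]

theorem IsH10.integral_energy (h : IsH10 Ω v K) (hΩ : MeasurableSet Ω) (hfin : volume Ω ≠ ⊤) :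
    Integrable (fun ξ => 4 * Real.pi ^ 2 * ‖ξ‖ ^ 2 * (cosCoef Ω v ξ ^ 2 + sinCoef Ω v ξ ^ 2)) ∧
      ∫ ξ, 4 * Real.pi ^ 2 * ‖ξ‖ ^ 2 * (cosCoef Ω v ξ ^ 2 + sinCoef Ω v ξ ^ 2)
        = ∫ x in Ω, ‖K x‖ ^ 2 := by
  have hi := integrableOn_of_memLp hfin h.memLp
  have hc := continuous_cosCoef hi
  have hs := continuous_sinCoef hi
  refine integral_of_lintegral_ofReal (Continuous.aestronglyMeasurable (by fun_prop))
    (fun ξ => by positivity) (integral_nonneg fun x => by positivity) ?_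
  rw [h.lintegral_energy hΩ hfin, ofReal_integral_eq_lintegral_ofReal
    h.memLp_grad.norm.integrable_sq (ae_of_all _ fun x => sq_nonneg _)]

end Coefficients

section Eigenbasis

variable {ι : Type*} {lam : ι → ℝ}
  {u : HilbertBasis ι ℝ (Lp ℝ 2 (volume.restrict Ω : Measure (Space d)))}

/-- Jensen in frequency space: by Plancherel the squared transform of `u j` has mass one, and
`4π²‖ξ‖²` has mean `lam j` against it. -/
theorem exp_eigenvalue_le (hΩ : MeasurableSet Ω) (hfin : volume Ω ≠ ⊤)
    (hu : ∀ j, DirichletLaplacianEq Ω (fun x => u j x) (fun x => lam j * u j x))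
    {t : ℝ} (ht : 0 < t) (j : ι) :
    Integrable (fun ξ : Space d => Real.exp (-t * (4 * Real.pi ^ 2 * ‖ξ‖ ^ 2))
      * (cosCoef Ω (u j) ξ ^ 2 + sinCoef Ω (u j) ξ ^ 2)) ∧
    Real.exp (-lam j * t) ≤ ∫ ξ : Space d, Real.exp (-t * (4 * Real.pi ^ 2 * ‖ξ‖ ^ 2))
      * (cosCoef Ω (u j) ξ ^ 2 + sinCoef Ω (u j) ξ ^ 2) := by
  obtain ⟨G, hG, hGE⟩ := exists_gradient_eigenfunction hu j
  obtain ⟨i1, e1⟩ := hG.integral_coef hΩ hfin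
  obtain ⟨i2, e2⟩ := hG.integral_energy hΩ hfin
  have hone : ∫ x in Ω, u j x ^ 2 = 1 := by
    have h := ofReal_integral_eq_lintegral_ofReal (Lp.memLp (u j)).integrable_sq
      (ae_of_all _ fun x => sq_nonneg (u j x))
    rw [lintegral_sq_basis] at h
    simpa using h
  rw [hone] at e1
  rw [hGE] at e2
  set a : Space d → ℝ := fun ξ => cosCoef Ω (u j) ξ ^ 2 + sinCoef Ω (u j) ξ ^ 2 with ha
  have ha0 : ∀ ξ, 0 ≤ a ξ := fun ξ => by positivity
  have i3 : Integrable fun ξ : Space d => Real.exp (-t * (4 * Real.pi ^ 2 * ‖ξ‖ ^ 2)) * a ξ := by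
    refine i1.bdd_mul (c := 1) (by fun_prop) (ae_of_all _ fun ξ => ?_)
    rw [Real.norm_of_nonneg (Real.exp_pos _).le, Real.exp_le_one_iff]
    have : 0 ≤ t * (4 * Real.pi ^ 2 * ‖ξ‖ ^ 2) := by positivity
    linarith
  refine ⟨i3, ?_⟩
  have i4 := ((i1.const_mul (1 + t * lam j)).sub (i2.const_mul t)).const_mul
    (Real.exp (-t * lam j))
  have hle := integral_mono i4 i3 fun ξ => by
    have := mul_le_mul_of_nonneg_right
      (exp_tangent_le t (lam j) (4 * Real.pi ^ 2 * ‖ξ‖ ^ 2)) (ha0 ξ)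
    refine le_trans (le_of_eq ?_) this
    simp only [Pi.sub_apply, ha]
    ring
  refine le_trans (le_of_eq ?_) hle
  rw [integral_const_mul]
  simp only [Pi.sub_apply]
  rw [integral_sub (i1.const_mul _) (i2.const_mul _), integral_const_mul, integral_const_mul,
    e1, e2]
  ring_nf

/-- Bessel's inequality for the cosine and the sine at frequency `ξ`, whose squared norms on `Ω` add
up to `|Ω|`. -/
theorem sum_coef_le (hfin : volume Ω ≠ ⊤) (F : Finset ι) (ξ : Space d) :
    ∑ j ∈ F, (cosCoef Ω (u j) ξ ^ 2 + sinCoef Ω (u j) ξ ^ 2) ≤ volume.real Ω := by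
  have h1 := sum_le_hasSum F (fun j _ => sq_nonneg _)
    (hasSum_sq_integral_basis (u := u) (memLp_cos hfin ξ))
  have h2 := sum_le_hasSum F (fun j _ => sq_nonneg _)
    (hasSum_sq_integral_basis (u := u) (memLp_sin hfin ξ))
  have h3 := add_le_add h1 h2
  rw [← Finset.sum_add_distrib, ← integral_add (memLp_cos hfin ξ).integrable_sq
    (memLp_sin hfin ξ).integrable_sq] at h3
  simp_rw [Real.cos_sq_add_sin_sq] at h3
  simp only [cosCoef, sinCoef]
  simpa [mul_comm] using h3

theorem summable_exp_eigenvalue (hΩ : MeasurableSet Ω) (hfin : volume Ω ≠ ⊤)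
    (hu : ∀ j, DirichletLaplacianEq Ω (fun x => u j x) (fun x => lam j * u j x))
    {t : ℝ} (ht : 0 < t) : Summable fun j => Real.exp (-lam j * t) := by
  refine summable_of_sum_le (c := ∫ ξ : Space d,
    Real.exp (-t * (4 * Real.pi ^ 2 * ‖ξ‖ ^ 2)) * volume.real Ω)
    (fun j => (Real.exp_pos _).le) fun F => ?_
  refine (Finset.sum_le_sum fun j _ => (exp_eigenvalue_le hΩ hfin hu ht j).2).trans ?_
  rw [← integral_finsetSum _ fun j _ => (exp_eigenvalue_le hΩ hfin hu ht j).1]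
  refine integral_mono (integrable_finsetSum _ fun j _ => (exp_eigenvalue_le hΩ hfin hu ht j).1)
    ((integrable_gaussian ht).mul_const _) fun ξ => ?_
  simp only [← Finset.mul_sum]
  exact mul_le_mul_of_nonneg_left (sum_coef_le hfin F ξ) (Real.exp_pos _).le

end Eigenbasis

/-! ### Cutoff functions -/

/-- A segment from a point of `Ω` to a point outside crosses the frontier. The lemma is needed
because the cutoff is built from the distance to the complement, whereas tubes use the distance to
the frontier. -/
theorem infDist_frontier_le_infDist_compl (hΩ : IsOpen Ω) (hne : Ωᶜ.Nonempty) {x : Space d} (hx : x ∈ Ω) :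
    Metric.infDist x (frontier Ω) ≤ Metric.infDist x Ωᶜ := by
  refine (Metric.le_infDist hne).2 fun y hy => ?_
  have hc : IsPreconnected (segment ℝ x y) := (convex_segment x y).isPreconnected
  obtain ⟨z, hz, hzf⟩ : (segment ℝ x y ∩ frontier Ω).Nonempty := by
    by_contra hemp
    have hoff : ∀ z ∈ segment ℝ x y, z ∈ closure Ω → z ∈ Ω := fun z hz hzc => by
      by_contra hzΩ
      exact hemp ⟨z, hz, hzc, by rwa [hΩ.interior_eq]⟩
    obtain ⟨w, -, hw1, hw2⟩ := hc Ω (closure Ω)ᶜ hΩ isClosed_closure.isOpen_compl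
      (fun z hz => (em (z ∈ closure Ω)).imp (hoff z hz) id)
      ⟨x, left_mem_segment ℝ x y, hx⟩
      ⟨y, right_mem_segment ℝ x y, fun h => hy (hoff y (right_mem_segment ℝ x y) h)⟩
    exact hw2 (subset_closure hw1)
  refine (Metric.infDist_le_dist_of_mem hzf).trans ?_
  have := dist_add_dist_of_mem_segment hz
  linarith [dist_nonneg (x := z) (y := y)]

open scoped Convolution in
-- An average of translates with total weight one keeps the Lipschitz constant, so smoothing costs
-- nothing in the gradient bound.
theorem lipschitzWith_normed_convolution {g : Space d → ℝ} {C : NNReal} (hg : LipschitzWith C g)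
    (ρ : ContDiffBump (0 : Space d)) :
    LipschitzWith C (ρ.normed volume ⋆[ContinuousLinearMap.lsmul ℝ ℝ, volume] g) := by
  have hi : ∀ x, Integrable (fun z => ρ.normed volume z • g (x - z)) := fun x =>
    Continuous.integrable_of_hasCompactSupport
      (ρ.continuous_normed.smul (hg.continuous.comp (by fun_prop)))
      ρ.hasCompactSupport_normed.smul_right
  refine LipschitzWith.of_dist_le_mul fun x y => ?_
  simp only [convolution_def, ContinuousLinearMap.lsmul_apply]
  rw [Real.dist_eq, ← integral_sub (hi x) (hi y)]
  refine (abs_integral_le_integral_abs).trans ?_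
  calc ∫ z, |ρ.normed volume z • g (x - z) - ρ.normed volume z • g (y - z)|
      ≤ ∫ z, ρ.normed volume z * (C * dist x y) := by
        refine integral_mono ((hi x).sub (hi y)).abs (ρ.integrable_normed.mul_const _) fun z => ?_
        simp only [smul_eq_mul, ← mul_sub, abs_mul, abs_of_nonneg (ρ.nonneg_normed z)]
        refine mul_le_mul_of_nonneg_left ?_ (ρ.nonneg_normed z)
        have := hg.dist_le_mul (x - z) (y - z)
        rwa [dist_sub_right, Real.dist_eq] at this
    _ = C * dist x y := by rw [integral_mul_const, ρ.integral_normed, one_mul]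

open scoped Convolution in
/-- A smooth cutoff function that is one off a tube around the boundary. -/
theorem exists_cutoff (hΩ : IsOpen Ω) (hb : Bornology.IsBounded Ω) (hne : Ωᶜ.Nonempty)
    {h r : ℝ} (hh : 0 < h) (hr : h < r) :
    ∃ φ : Space d → ℝ, IsTestFunction Ω φ ∧ (∀ x, |φ x| ≤ 1) ∧ (∀ x, ‖gradient φ x‖ ≤ 1 / h) ∧
      ∀ x ∈ Ω, x ∉ tube Ω r → φ x = 1 ∧ gradient φ x = 0 := by
  -- The ramp `g` rises from 0 at depth `ε` to 1 at depth `h + ε`, and the mollifier has radius `ε /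
  -- 2`. Thus `φ` vanishes at depth below `ε / 2` and is 1 beyond depth `h + 2 * ε = r`.
  set ε := (r - h) / 2 with hε
  have hε0 : 0 < ε := by rw [hε]; linarith
  let δ : Space d → ℝ := fun x => Metric.infDist x Ωᶜ
  have hδ : LipschitzWith 1 δ := Metric.lipschitz_infDist_pt _
  have hδc : Continuous δ := hδ.continuous
  have hδd : ∀ x y, |δ x - δ y| ≤ dist x y := fun x y => by
    simpa [Real.dist_eq] using hδ.dist_le_mul x y
  let g : Space d → ℝ := fun x => min 1 (max 0 ((δ x - ε) / h))
  let C : NNReal := ⟨1 / h, by positivity⟩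
  have hg : LipschitzWith C g := by
    have : LipschitzWith C fun x => (δ x - ε) / h := LipschitzWith.of_dist_le_mul fun x y => by
      rw [Real.dist_eq, ← sub_div, abs_div, abs_of_pos hh, sub_sub_sub_cancel_right]
      change _ ≤ 1 / h * dist x y
      rw [one_div, div_eq_inv_mul]
      exact mul_le_mul_of_nonneg_left (hδd x y) (by positivity)
    exact (this.const_max 0).const_min 1
  have hg0 : ∀ x, 0 ≤ g x := fun x => le_min zero_le_one (le_max_left _ _)
  have hg1 : ∀ x, g x ≤ 1 := fun x => min_le_left _ _
  let ρ : ContDiffBump (0 : Space d) := ⟨ε / 4, ε / 2, by linarith, by linarith⟩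
  let φ : Space d → ℝ := ρ.normed volume ⋆[ContinuousLinearMap.lsmul ℝ ℝ, volume] g
  have hφL : LipschitzWith C φ := lipschitzWith_normed_convolution hg ρ
  have hsupp : tsupport φ ⊆ {x | ε / 2 ≤ δ x} := by
    refine closure_minimal (fun x hx => ?_) (isClosed_le continuous_const hδc)
    by_contra hlt
    simp only [Set.mem_ofPred_eq, not_le] at hlt
    have hz : ∀ y, δ y ≤ ε → g y = 0 := fun y hy => by
      have : (δ y - ε) / h ≤ 0 := div_nonpos_of_nonpos_of_nonneg (by linarith) hh.le
      simp [g, max_eq_left this]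
    have e : φ x = g x := ρ.normed_convolution_eq_right fun y hy => by
      have h1 := (abs_le.1 (hδd y x)).2
      have h2 : dist y x < ε / 2 := hy
      rw [hz y (by linarith), hz x (by linarith)]
    exact hx (by rw [e, hz x (by linarith)])
  have hsub : tsupport φ ⊆ Ω := fun x hx => by
    by_contra hxΩ
    have h1 : δ x = 0 := Metric.infDist_zero_of_mem hxΩ
    have h2 := hsupp hx
    simp only [Set.mem_ofPred_eq] at h2
    linarith
  have hone : ∀ x, h + 2 * ε < δ x → φ x = 1 := by
    intro x hx
    have hz : ∀ y, h + ε ≤ δ y → g y = 1 := fun y hy => by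
      have : 1 ≤ (δ y - ε) / h := by rw [le_div_iff₀ hh]; linarith
      exact min_eq_left (le_max_of_le_right this)
    have e : φ x = g x := ρ.normed_convolution_eq_right fun y hy => by
      have h1 := (abs_le.1 (hδd y x)).1
      have h2 : dist y x < ε / 2 := hy
      rw [hz y (by linarith), hz x (by linarith)]
    rw [e, hz x (by linarith)]
  have hi : ∀ x, Integrable (fun z => ρ.normed volume z • g (x - z)) := fun x =>
    Continuous.integrable_of_hasCompactSupport
      (ρ.continuous_normed.smul (hg.continuous.comp (by fun_prop)))
      ρ.hasCompactSupport_normed.smul_right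
  have hval : ∀ x, φ x = ∫ z, ρ.normed volume z • g (x - z) := fun x => rfl
  refine ⟨φ, ⟨?_, ?_, hsub⟩, fun x => ?_, fun x => ?_, fun x hx hxt => ?_⟩
  · exact ρ.hasCompactSupport_normed.contDiff_convolution_left _ ρ.contDiff_normed
      hg.continuous.locallyIntegrable
  · exact Metric.isCompact_of_isClosed_isBounded (isClosed_tsupport _) (hb.subset hsub)
  · rw [hval, abs_of_nonneg (integral_nonneg fun z => mul_nonneg (ρ.nonneg_normed z) (hg0 _)),
      ← ρ.integral_normed (μ := volume)]
    exact integral_mono (hi x) ρ.integrable_normed fun z =>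
      mul_le_of_le_one_right (ρ.nonneg_normed z) (hg1 _)
  · have := norm_fderiv_le_of_lipschitz ℝ hφL (x₀ := x)
    refine le_trans (le_of_eq ?_) this
    simp [gradient]
  · have hlt : h + 2 * ε < δ x := by
      have h1 : ¬ Metric.infDist x (frontier Ω) ≤ r := fun hle => hxt ⟨hx, hle⟩
      have h2 := infDist_frontier_le_infDist_compl hΩ hne hx
      simp only [hε, δ]
      linarith [not_le.1 h1]
    refine ⟨hone x hlt, ?_⟩
    have hev : φ =ᶠ[𝓝 x] fun _ => 1 := by
      filter_upwards [hδc.continuousAt.eventually (lt_mem_nhds hlt)] with y hy using hone y hy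
    rw [hev.gradient_eq, gradient_fun_const]

/-! ### From cutoff functions to the tube bound -/

theorem measurableSet_tube (hΩ : IsOpen Ω) (r : ℝ) : MeasurableSet (tube Ω r) :=
  hΩ.measurableSet.inter
    (isClosed_le (Metric.continuous_infDist_pt _) continuous_const).measurableSet

/-- On `Ω`, the cutoff is 1 off the tube, and `h²‖∇φ‖²` is at most the indicator of the tube. Each
of the two terms loses one tube volume, hence the factor 2. -/
theorem exists_testFunction_energy_le (hΩ : IsOpen Ω) (hb : Bornology.IsBounded Ω)
    (hne : Ωᶜ.Nonempty) {h r : ℝ} (hh : 0 < h) (hr : h < r) :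
    ∃ φ : Space d → ℝ, IsTestFunction Ω φ ∧ (∀ x, |φ x| ≤ 1) ∧
      volume.real Ω - 2 * volume.real (tube Ω r)
        ≤ (∫ x in Ω, φ x ^ 2) - h ^ 2 * ∫ x in Ω, ‖gradient φ x‖ ^ 2 := by
  obtain ⟨φ, hφ, h1, h2, h3⟩ := exists_cutoff hΩ hb hne hh hr
  refine ⟨φ, hφ, h1, ?_⟩
  have hfin : volume Ω ≠ ⊤ := hb.measure_lt_top.ne
  have hT := measurableSet_tube hΩ r
  have hTsub : tube Ω r ⊆ Ω := fun x hx => hx.1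
  have hTfin : volume (tube Ω r) ≠ ⊤ := measure_ne_top_of_subset hTsub hfin
  have eT : ∫ x in Ω, (tube Ω r).indicator (fun _ => (1 : ℝ)) x = volume.real (tube Ω r) := by
    rw [integral_indicator_const _ hT]
    simp [measureReal_restrict_apply hT, Set.inter_eq_left.2 hTsub]
  have eΩ : ∫ _ in Ω, (1 : ℝ) = volume.real Ω := by simp
  have iT : Integrable ((tube Ω r).indicator fun _ => (1 : ℝ)) (volume.restrict Ω) :=
    (integrable_indicator_iff hT).2 (by
      refine integrableOn_const ?_
      exact ((Measure.restrict_apply_le _ _).trans_lt hTfin.lt_top).ne)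
  have iO : Integrable (fun _ => (1 : ℝ)) (volume.restrict Ω) := integrableOn_const hfin
  have l1 : volume.real Ω - volume.real (tube Ω r) ≤ ∫ x in Ω, φ x ^ 2 := by
    rw [← eT, ← eΩ, ← integral_sub iO iT]
    refine setIntegral_mono_on (iO.sub iT) (hφ.memLp 2 _).integrable_sq hΩ.measurableSet
      fun x hx => ?_
    by_cases hxT : x ∈ tube Ω r
    · simp only [hxT, Set.indicator_of_mem, sub_self]
      positivity
    · simp [hxT, (h3 x hx hxT).1]
  have l2 : h ^ 2 * ∫ x in Ω, ‖gradient φ x‖ ^ 2 ≤ volume.real (tube Ω r) := by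
    rw [← eT, ← integral_const_mul]
    refine setIntegral_mono_on ((hφ.memLp_gradient 2 _).norm.integrable_sq.const_mul _) iT
      hΩ.measurableSet fun x hx => ?_
    by_cases hxT : x ∈ tube Ω r
    · simp only [hxT, Set.indicator_of_mem]
      have := mul_le_mul_of_nonneg_left (h2 x) hh.le
      rw [mul_one_div_cancel hh.ne'] at this
      rw [← mul_pow]
      exact pow_le_one₀ (by positivity) this
    · simp [hxT, (h3 x hx hxT).2]
  linarith

/-- The closed inequality in `tube` makes the volume right continuous, so the room `h < r` needed
for smoothing disappears in the limit. -/
theorem tendsto_measureReal_tube (hΩ : IsOpen Ω) (hfin : volume Ω ≠ ⊤) (h : ℝ) :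
    Tendsto (fun r => volume.real (tube Ω r)) (𝓝[>] h) (𝓝 (volume.real (tube Ω h))) := by
  have hfin' : ∀ r, volume (tube Ω r) ≠ ⊤ := fun r =>
    measure_ne_top_of_subset (fun x hx => hx.1) hfin
  have e : ⋂ r > h, tube Ω r = tube Ω h := by
    ext x
    simp only [Set.mem_iInter]
    refine ⟨fun hx => ⟨(hx (h + 1) (by simp)).1, le_of_forall_gt_imp_ge_of_dense
      fun r hr => (hx r hr).2⟩, fun hx r hr => ⟨hx.1, hx.2.trans (le_of_lt hr)⟩⟩
  have := tendsto_measure_biInter_gt (μ := volume) (s := tube Ω) (a := h)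
    (fun r _ => (measurableSet_tube hΩ r).nullMeasurableSet)
    (fun i j _ hij x hx => ⟨hx.1, hx.2.trans hij⟩) ⟨h + 1, by simp, hfin' _⟩
  rw [e] at this
  exact (ENNReal.tendsto_toReal (hfin' h)).comp this

theorem heatTrace_lower_bound_tube {ι : Type*} [Countable ι] {lam : ι → ℝ}
    {u : HilbertBasis ι ℝ (Lp ℝ 2 (volume.restrict Ω : Measure (Space d)))}
    (hΩ : IsOpen Ω) (hb : Bornology.IsBounded Ω) (hne : Ωᶜ.Nonempty)
    (hu : ∀ j, DirichletLaplacianEq Ω (fun x => u j x) (fun x => lam j * u j x))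
    {t : ℝ} (ht : 0 < t) :
    (volume.real Ω - 2 * volume.real (tube Ω (√t))) / (4 * Real.pi * t) ^ ((d : ℝ) / 2)
      ≤ ∑' j, Real.exp (-lam j * t) := by
  have hfin : volume Ω ≠ ⊤ := hb.measure_lt_top.ne
  have hs := summable_exp_eigenvalue hΩ.measurableSet hfin hu ht
  have hlim : Tendsto (fun r => (volume.real Ω - 2 * volume.real (tube Ω r))
      / (4 * Real.pi * t) ^ ((d : ℝ) / 2)) (𝓝[>] √t)
      (𝓝 ((volume.real Ω - 2 * volume.real (tube Ω (√t)))
        / (4 * Real.pi * t) ^ ((d : ℝ) / 2))) :=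
    (((tendsto_measureReal_tube hΩ hfin _).const_mul 2).const_sub _).div_const _
  refine le_of_tendsto hlim ?_
  filter_upwards [self_mem_nhdsWithin] with r hr
  obtain ⟨φ, hφ, h1, h2⟩ := exists_testFunction_energy_le hΩ hb hne (Real.sqrt_pos.2 ht) hr
  rw [Real.sq_sqrt ht.le] at h2
  have h3 := heatTrace_lower_bound hΩ.measurableSet hfin hu hφ h1 ht
  simp_rw [neg_mul, mul_comm t, ← neg_mul] at h3
  rw [← ENNReal.ofReal_tsum_of_nonneg (fun j => (Real.exp_pos _).le) hs,
    ENNReal.ofReal_le_ofReal_iff (tsum_nonneg fun j => (Real.exp_pos _).le)] at h3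
  refine le_trans ?_ h3
  rw [mul_comm (∫ x in Ω, ‖gradient φ x‖ ^ 2)]
  exact div_le_div_of_nonneg_right h2 (by positivity)

/-! ### Compact operators on Hilbert spaces -/

section Hilbert

variable {E H : Type*} [NormedAddCommGroup E] [InnerProductSpace ℝ E]


/-- Distinct orthonormal vectors are at distance `√2`, so balls of radius `1 / 2` around them are
disjoint. -/
theorem countable_of_orthonormal [TopologicalSpace.SeparableSpace E] {ι : Type*} {v : ι → E}
    (hv : Orthonormal ℝ v) : Countable ι := by
  have hd : Pairwise fun i j => Disjoint (Metric.ball (v i) (1 / 2)) (Metric.ball (v j) (1 / 2)) := by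
    intro i j hij
    refine Metric.ball_disjoint_ball ?_
    have h := norm_sub_sq_real (v i) (v j)
    rw [hv.1, hv.1, hv.2 hij] at h
    rw [dist_eq_norm]
    nlinarith [norm_nonneg (v i - v j)]
  exact hd.countable_of_isOpen_disjoint (fun i => Metric.isOpen_ball)
    (fun i => ⟨v i, Metric.mem_ball_self (by norm_num)⟩)

variable [CompleteSpace E] [NormedAddCommGroup H] [InnerProductSpace ℝ H] [CompleteSpace H]

/-- An operator is compact if it is small off finitely many directions. -/
theorem isCompactOperator_of_finite_codim (J : H →L[ℝ] E)
    (h : ∀ ε > 0, ∃ F : Set E, F.Finite ∧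
      ∀ x : H, (∀ f ∈ F, inner ℝ f (J x) = 0) → ‖J x‖ ≤ ε * ‖x‖) :
    IsCompactOperator J := by
  have key : ∀ ε > 0, ∃ T : H →L[ℝ] E, IsCompactOperator T ∧ ‖T - J‖ ≤ ε := by
    intro ε hε
    obtain ⟨F, hF, hFJ⟩ := h ε hε
    -- Vectors orthogonal to `W` satisfy the conditions given by `F`, so `J` is small on the
    -- complement of `W`, and `J` composed with the projection to `W` is a finite-rank
    -- approximation.
    let W : Submodule ℝ H := Submodule.span ℝ ((ContinuousLinearMap.adjoint J) '' F)
    have : FiniteDimensional ℝ W := FiniteDimensional.span_of_finite ℝ (hF.image _)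
    refine ⟨J ∘L W.starProjection, ?_, ?_⟩
    · have h1 : IsCompactOperator (J ∘L W.subtypeL) :=
        isCompactOperator_of_locallyCompactSpace_rng (J ∘L W.subtypeL)
      exact h1.comp_clm W.orthogonalProjectionOnto
    · refine ContinuousLinearMap.opNorm_le_bound _ hε.le fun x => ?_
      have hmem : x - W.starProjection x ∈ Wᗮ := W.sub_starProjection_mem_orthogonal x
      have hle : ‖x - W.starProjection x‖ ≤ ‖x‖ := by
        rw [← Submodule.starProjection_orthogonal_val]
        exact Wᗮ.norm_starProjection_apply_le x
      have h2 := hFJ (x - W.starProjection x) fun f hf => by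
        rw [← ContinuousLinearMap.adjoint_inner_left]
        exact Submodule.inner_right_of_mem_orthogonal
          (Submodule.subset_span (Set.mem_image_of_mem _ hf)) hmem
      have e : (J ∘L W.starProjection - J) x = -(J (x - W.starProjection x)) := by
        simp
      rw [e, norm_neg]
      exact h2.trans (mul_le_mul_of_nonneg_left hle hε.le)
  choose T hT hTJ using fun n : ℕ => key (1 / (n + 1)) (by positivity)
  refine isCompactOperator_of_tendsto (l := atTop) (F := T) ?_ (Eventually.of_forall hT)
  rw [tendsto_iff_norm_sub_tendsto_zero]
  exact squeeze_zero (fun n => norm_nonneg _) hTJ tendsto_one_div_add_atTop_nhds_zero_nat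

end Hilbert

/-- A compact symmetric operator has a Hilbert basis of eigenvectors. -/
theorem exists_hilbertBasis_eigenvectors.{v} {E : Type v} [NormedAddCommGroup E]
    [InnerProductSpace ℝ E] [CompleteSpace E] {T : E →L[ℝ] E} (hT : IsCompactOperator T)
    (hs : T.IsSymmetric) :
    ∃ (ι : Type v) (b : HilbertBasis ι ℝ E) (μ : ι → ℝ), ∀ i, T (b i) = μ i • b i := by
  let V : ℝ → Submodule ℝ E := fun μ => Module.End.eigenspace (T : E →ₗ[ℝ] E) μ
  have hclosed : ∀ μ, IsClosed (V μ : Set E) := fun μ => by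
    have : (V μ : Set E) = {x | T x = μ • x} := by
      ext x
      simp [V]
    rw [this]
    exact isClosed_eq T.continuous (continuous_const_smul μ)
  have hcomp : ∀ μ, CompleteSpace (V μ) := fun μ => (hclosed μ).completeSpace_coe
  -- Bases of all eigenspaces are glued over every real `μ`. The kernel may be infinite-dimensional,
  -- so Hilbert bases are used.
  choose w b hb using fun μ => exists_hilbertBasis ℝ (V μ)
  let v : (Σ μ, w μ) → E := fun a => (b a.1 a.2 : E)
  have hv : Orthonormal ℝ v :=
    hs.orthogonalFamily_eigenspaces.orthonormal_sigma_orthonormal fun μ => (b μ).orthonormal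
  have hsp : (Submodule.span ℝ (Set.range v))ᗮ = ⊥ := by
    rw [eq_bot_iff, ← T.orthogonalComplement_iSup_eigenspaces_eq_bot hT hs]
    intro x hx
    rw [← Submodule.iInf_orthogonal, Submodule.mem_iInf]
    intro μ
    have h0 : (innerSL ℝ x) ∘L (V μ).subtypeL = 0 := by
      refine ContinuousLinearMap.ext_on (s := Set.range (b μ)) ?_ ?_
      · rw [Submodule.dense_iff_topologicalClosure_eq_top]
        exact (b μ).dense_span
      · rintro _ ⟨i, rfl⟩
        exact Submodule.inner_left_of_mem_orthogonal (Submodule.subset_span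
          (Set.mem_range_self (⟨μ, i⟩ : Σ μ, w μ))) hx
    refine (Submodule.mem_orthogonal' _ _).2 fun y hy => ?_
    exact congrArg (fun f => f ⟨y, hy⟩) h0
  obtain ⟨B, hB⟩ : ∃ B : HilbertBasis (Σ μ, w μ) ℝ E, ⇑B = v :=
    ⟨_, HilbertBasis.coe_mkOfOrthogonalEqBot hv hsp⟩
  refine ⟨Σ μ, w μ, B, fun a => a.1, fun a => ?_⟩
  rw [hB]
  have h : ∀ x : V a.1, T x = a.1 • (x : E) := fun x => Module.End.mem_eigenspace_iff.1 x.2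
  exact h (b a.1 a.2)

/-! ### The energy space -/

theorem gradient_fun_add {f g : Space d → ℝ} {x : Space d} (hf : DifferentiableAt ℝ f x)
    (hg : DifferentiableAt ℝ g x) :
    gradient (fun y => f y + g y) x = gradient f x + gradient g x := by
  refine ext_inner_right ℝ fun v => ?_
  rw [inner_gradient_left, fderiv_fun_add hf hg, inner_add_left, inner_gradient_left,
    inner_gradient_left]
  rfl

theorem gradient_fun_const_mul {f : Space d → ℝ} {x : Space d} (hf : DifferentiableAt ℝ f x)
    (c : ℝ) : gradient (fun y => c * f y) x = c • gradient f x := by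
  refine ext_inner_right ℝ fun v => ?_
  rw [inner_gradient_left, fderiv_const_mul hf, real_inner_smul_left, inner_gradient_left]
  rfl

theorem IsTestFunction.zero : IsTestFunction Ω (fun _ => 0) where
  smooth := contDiff_const
  compact_support := HasCompactSupport.zero
  support_subset := by
    have : tsupport (fun _ : Space d => (0 : ℝ)) = ∅ := tsupport_eq_empty_iff.2 rfl
    simp [this]

theorem IsTestFunction.add {φ ψ : Space d → ℝ} (hφ : IsTestFunction Ω φ)
    (hψ : IsTestFunction Ω ψ) : IsTestFunction Ω (fun x => φ x + ψ x) where
  smooth := hφ.smooth.add hψ.smooth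
  compact_support := hφ.compact_support.add hψ.compact_support
  support_subset := (tsupport_add φ ψ).trans (Set.union_subset hφ.support_subset hψ.support_subset)

theorem IsTestFunction.const_mul {φ : Space d → ℝ} (hφ : IsTestFunction Ω φ) (c : ℝ) :
    IsTestFunction Ω (fun x => c * φ x) where
  smooth := contDiff_const.mul hφ.smooth
  compact_support := hφ.compact_support.mul_left
  support_subset := tsupport_mul_subset_right.trans hφ.support_subset

/-- The ambient Hilbert space of the pairs `(u, ∇u)`. -/
abbrev PairSpace (Ω : Set (Space d)) : Type :=
  WithLp 2 (Lp ℝ 2 (volume.restrict Ω : Measure (Space d)) ×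
    Lp (Space d) 2 (volume.restrict Ω : Measure (Space d)))

/-- The pairs `(φ, ∇φ)` of test functions. -/
noncomputable def testPairs (Ω : Set (Space d)) : Submodule ℝ (PairSpace Ω) where
  carrier := {p | ∃ φ : Space d → ℝ, IsTestFunction Ω φ ∧
    p.fst =ᵐ[volume.restrict Ω] φ ∧ p.snd =ᵐ[volume.restrict Ω] gradient φ}
  zero_mem' := ⟨fun _ => 0, IsTestFunction.zero, Lp.coeFn_zero ℝ 2 (volume.restrict Ω), by
    rw [gradient_fun_const']
    exact Lp.coeFn_zero (Space d) 2 (volume.restrict Ω)⟩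
  add_mem' := by
    rintro p q ⟨φ, hφ, h1, h2⟩ ⟨ψ, hψ, h3, h4⟩
    refine ⟨_, hφ.add hψ, ?_, ?_⟩
    · rw [WithLp.add_fst]
      filter_upwards [Lp.coeFn_add p.fst q.fst, h1, h3] with x h h' h''
      rw [h, Pi.add_apply, h', h'']
    · rw [WithLp.add_snd]
      filter_upwards [Lp.coeFn_add p.snd q.snd, h2, h4] with x h h' h''
      rw [h, Pi.add_apply, h', h'', gradient_fun_add (hφ.smooth.differentiable (by simp) x)
        (hψ.smooth.differentiable (by simp) x)]
  smul_mem' := by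
    rintro c p ⟨φ, hφ, h1, h2⟩
    refine ⟨_, hφ.const_mul c, ?_, ?_⟩
    · rw [WithLp.smul_fst]
      filter_upwards [Lp.coeFn_smul c p.fst, h1] with x h h'
      rw [h, Pi.smul_apply, h', smul_eq_mul]
    · rw [WithLp.smul_snd]
      filter_upwards [Lp.coeFn_smul c p.snd, h2] with x h h'
      rw [h, Pi.smul_apply, h', gradient_fun_const_mul (hφ.smooth.differentiable (by simp) x)]

/-- The space `H¹₀(Ω)` of the pairs `(u, ∇u)`. -/
noncomputable def energySpace (Ω : Set (Space d)) : Submodule ℝ (PairSpace Ω) :=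
  (testPairs Ω).topologicalClosure

instance : CompleteSpace (energySpace Ω) :=
  (Submodule.isClosed_topologicalClosure _).completeSpace_coe

/-- The weak gradient identity holds for test functions and survives `L²` limits, so approximation
alone gives membership. -/
theorem IsH10.of_tendsto {u : Space d → ℝ} {G : Space d → Space d}
    (hu : MemLp u 2 (volume.restrict Ω)) (hG : MemLp G 2 (volume.restrict Ω))
    {φ : ℕ → Space d → ℝ} (hφ : ∀ n, IsTestFunction Ω (φ n))
    (h1 : Tendsto (fun n => eLpNorm (fun x => φ n x - u x) 2 (volume.restrict Ω)) atTop (𝓝 0))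
    (h2 : Tendsto (fun n => eLpNorm (fun x => gradient (φ n) x - G x) 2 (volume.restrict Ω))
      atTop (𝓝 0)) : IsH10 Ω u G where
  memLp := hu
  memLp_grad := hG
  approx := ⟨φ, hφ, h1, h2⟩
  integral_eq ψ hψ := by
    have i1 : Integrable (fun x => u x • gradient ψ x) (volume.restrict Ω) :=
      memLp_one_iff_integrable.1 ((hψ.memLp_gradient 2 _).smul (p := 2) (q := 2) (r := 1) hu)
    have i2 : Integrable (fun x => ψ x • G x) (volume.restrict Ω) :=
      memLp_one_iff_integrable.1 (hG.smul (p := 2) (q := 2) (r := 1) (hψ.memLp 2 _))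
    refine ext_inner_left ℝ fun e => ?_
    rw [inner_neg_right, ← integral_inner i1, ← integral_inner i2]
    have m1 : MemLp (fun x => ψ x • e) 2 (volume.restrict Ω) :=
      (hψ.smooth.continuous.smul continuous_const).memLp_of_hasCompactSupport
        hψ.compact_support.smul_right
    have m2 : MemLp (fun x => (inner ℝ (gradient ψ x) e : ℝ)) 2 (volume.restrict Ω) :=
      (hψ.memLp_gradient 2 _).inner_const e
    have t1 := (tendsto_integral_inner (fun n => (hφ n).memLp_gradient 2 _) hG m1 h2).neg
    have t2 := tendsto_integral_inner (fun n => (hφ n).memLp 2 _) hu m2 h1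
    simp only [(hφ _).integral_inner_gradient hψ.smooth e, neg_neg] at t1
    have t3 := tendsto_nhds_unique (t1.congr fun n => by simp [mul_comm]) t2
    simp_rw [inner_smul_right, real_inner_comm] at t3 ⊢
    simpa [mul_comm] using t3.symm

theorem isH10_of_mem_energySpace {p : PairSpace Ω} (hp : p ∈ energySpace Ω) :
    IsH10 Ω (fun x => p.fst x) (fun x => p.snd x) := by
  obtain ⟨q, hq, hlim⟩ := mem_closure_iff_seq_limit.1 hp
  choose φ hφ h1 h2 using hq
  have t1 : Tendsto (fun n => (q n).fst) atTop (𝓝 p.fst) :=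
    ((WithLp.fstL 2 ℝ _ _).continuous.tendsto p).comp hlim
  have t2 : Tendsto (fun n => (q n).snd) atTop (𝓝 p.snd) :=
    ((WithLp.sndL 2 ℝ _ _).continuous.tendsto p).comp hlim
  rw [Lp.tendsto_Lp_iff_tendsto_eLpNorm'] at t1 t2
  refine IsH10.of_tendsto (Lp.memLp _) (Lp.memLp _) hφ (t1.congr fun n => eLpNorm_congr_ae ?_)
    (t2.congr fun n => eLpNorm_congr_ae ?_)
  · filter_upwards [h1 n] with x hx
    rw [Pi.sub_apply, hx]
  · filter_upwards [h2 n] with x hx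
    rw [Pi.sub_apply, hx]

theorem IsH10.mem_energySpace {v : Space d → ℝ} {K : Space d → Space d} (h : IsH10 Ω v K) :
    WithLp.toLp 2 (h.memLp.toLp v, h.memLp_grad.toLp K) ∈ energySpace Ω := by
  obtain ⟨φ, hφ, h1, h2⟩ := h.approx
  refine mem_closure_of_tendsto (b := atTop) (f := fun n => WithLp.toLp 2
    (((hφ n).memLp 2 (volume.restrict Ω)).toLp (φ n),
      ((hφ n).memLp_gradient 2 (volume.restrict Ω)).toLp (gradient (φ n)))) ?_ ?_
  · exact ((WithLp.prodContinuousLinearEquiv 2 ℝ _ _).symm.continuous.tendsto _).comp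
      ((tendsto_toLp (fun n => (hφ n).memLp 2 _) h.memLp h1).prodMk_nhds 
        (tendsto_toLp (fun n => (hφ n).memLp_gradient 2 _) h.memLp_grad h2))
  · exact Eventually.of_forall fun n => ⟨φ n, hφ n, ((hφ n).memLp 2 _).coeFn_toLp,
      ((hφ n).memLp_gradient 2 _).coeFn_toLp⟩

/-- The embedding of `H¹₀(Ω)` into `L²(Ω)`. -/
noncomputable def energyEmbedding (Ω : Set (Space d)) :
    energySpace Ω →L[ℝ] Lp ℝ 2 (volume.restrict Ω : Measure (Space d)) :=
  (WithLp.fstL 2 ℝ _ _) ∘L (energySpace Ω).subtypeL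

/-! ### Compactness of the embedding -/

theorem cosCoef_eq_inner (hfin : volume Ω ≠ ⊤)
    (u : Lp ℝ 2 (volume.restrict Ω : Measure (Space d))) (ξ : Space d) :
    cosCoef Ω u ξ = inner ℝ ((memLp_cos hfin ξ).toLp _) u := by
  have := inner_toLp_toLp (memLp_cos hfin ξ) (Lp.memLp u)
  rw [Lp.toLp_coeFn] at this
  rw [this, cosCoef]
  simp [mul_comm]

theorem sinCoef_eq_inner (hfin : volume Ω ≠ ⊤)
    (u : Lp ℝ 2 (volume.restrict Ω : Measure (Space d))) (ξ : Space d) :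
    sinCoef Ω u ξ = inner ℝ ((memLp_sin hfin ξ).toLp _) u := by
  have := inner_toLp_toLp (memLp_sin hfin ξ) (Lp.memLp u)
  rw [Lp.toLp_coeFn] at this
  rw [this, sinCoef]
  simp [mul_comm]

/-- On a bounded set the phase moves by at most `2πM` times the change of frequency, so the waves
depend on the frequency in a Lipschitz way. `F` stands for cosine or sine. -/
theorem norm_toLp_sub_le (hΩ : MeasurableSet Ω) {M : ℝ} (hM0 : 0 ≤ M)
    (hM : ∀ x ∈ Ω, ‖x‖ ≤ M)
    (hfin : volume Ω ≠ ⊤)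
    {F : ℝ → ℝ} (hF : LipschitzWith 1 F)
    (hm : ∀ ξ, MemLp (fun x : Space d => F (2 * Real.pi * inner ℝ x ξ)) 2 (volume.restrict Ω))
    (ξ η : Space d) :
    ‖(hm ξ).toLp _ - (hm η).toLp _‖
      ≤ (volume Ω).toReal ^ (1 / 2 : ℝ) * (2 * Real.pi * M) * dist ξ η := by
  have : IsFiniteMeasure (volume.restrict Ω) := ⟨by simpa using hfin.lt_top⟩
  have h := Lp.norm_le_of_ae_bound (f := (hm ξ).toLp _ - (hm η).toLp _)
    (C := 2 * Real.pi * M * dist ξ η) (by positivity) (by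
      filter_upwards [Lp.coeFn_sub ((hm ξ).toLp _) ((hm η).toLp _), (hm ξ).coeFn_toLp,
        (hm η).coeFn_toLp, ae_restrict_mem hΩ] with x h1 h2 h3 hx
      rw [h1, Pi.sub_apply, h2, h3, ← dist_eq_norm]
      refine (hF.dist_le_mul _ _).trans ?_
      rw [NNReal.coe_one, one_mul, Real.dist_eq, ← mul_sub, ← inner_sub_right, abs_mul,
        abs_of_nonneg (by positivity : 0 ≤ 2 * Real.pi), dist_eq_norm, mul_assoc (2 * Real.pi)]
      refine mul_le_mul_of_nonneg_left ?_ (by positivity)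
      exact (abs_real_inner_le_norm _ _).trans
        (mul_le_mul_of_nonneg_right (hM x hx) (norm_nonneg _)))
  refine h.trans (le_of_eq ?_)
  simp only [measureUnivNNReal, Measure.restrict_apply_univ, ENNReal.toReal_ofNat, one_div,
    mul_assoc]
  rfl

/-- Orthogonality to `f` on a finite net of the compact ball controls `f` on the whole ball. The
mesh uses `κ + 1` because `κ` may vanish. -/
theorem exists_finite_small_inner {E : Type*} [NormedAddCommGroup E] [InnerProductSpace ℝ E]
    {f : Space d → E} {κ : ℝ} (hκ : 0 ≤ κ) (hf : ∀ ξ η, ‖f ξ - f η‖ ≤ κ * dist ξ η) (R : ℝ) {δ : ℝ}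
    (hδ : 0 < δ) :
    ∃ F : Set E, F.Finite ∧ ∀ u : E, (∀ g ∈ F, inner ℝ g u = 0) →
      ∀ ξ ∈ Metric.closedBall 0 R, |inner ℝ (f ξ) u| ≤ δ * ‖u‖ := by
  obtain ⟨S, -, hSf, hS⟩ := (isCompact_closedBall (0 : Space d) R).finite_cover_balls
    (e := δ / (κ + 1)) (by positivity)
  refine ⟨f '' S, hSf.image f, fun u hu ξ hξ => ?_⟩
  obtain ⟨η, hη, hd⟩ := Set.mem_iUnion₂.1 (hS hξ)
  have e : inner ℝ (f ξ) u = inner ℝ (f ξ - f η) u := by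
    rw [inner_sub_left, hu _ (Set.mem_image_of_mem f hη), sub_zero]
  rw [e]
  refine (abs_real_inner_le_norm _ _).trans (mul_le_mul_of_nonneg_right ?_ (norm_nonneg _))
  refine (hf ξ η).trans ?_
  have h1 : dist ξ η * (κ + 1) ≤ δ := by
    rw [← le_div_iff₀ (by positivity)]
    exact (Metric.mem_ball.1 hd).le
  nlinarith [dist_nonneg (x := ξ) (y := η)]

theorem norm_sq_pairSpace (p : PairSpace Ω) :
    ‖p‖ ^ 2 = (∫ x in Ω, p.fst x ^ 2) + ∫ x in Ω, ‖p.snd x‖ ^ 2 := by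
  rw [← real_inner_self_eq_norm_sq, WithLp.prod_inner_apply, L2.inner_def, L2.inner_def]
  simp

theorem norm_sq_eq_integral (u : Lp ℝ 2 (volume.restrict Ω : Measure (Space d))) :
    ‖u‖ ^ 2 = ∫ x in Ω, u x ^ 2 := by
  rw [← real_inner_self_eq_norm_sq, L2.inner_def]
  simp

/-- Plancherel with the frequencies split at radius `R`: inside, the bound `A` times the volume of
the ball; outside, the energy divided by `R²`. -/
theorem IsH10.integral_sq_le {v : Space d → ℝ} {K : Space d → Space d} (h : IsH10 Ω v K)
    (hΩ : MeasurableSet Ω) (hfin : volume Ω ≠ ⊤) {R A : ℝ} (hR : 0 < R)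
    (hA : ∀ ξ ∈ Metric.closedBall (0 : Space d) R, cosCoef Ω v ξ ^ 2 + sinCoef Ω v ξ ^ 2 ≤ A) :
    ∫ x in Ω, v x ^ 2 ≤ volume.real (Metric.closedBall (0 : Space d) R) * A
      + (∫ x in Ω, ‖K x‖ ^ 2) / R ^ 2 := by
  obtain ⟨i1, e1⟩ := h.integral_coef hΩ hfin
  obtain ⟨i2, e2⟩ := h.integral_energy hΩ hfin
  have hB : volume (Metric.closedBall (0 : Space d) R) ≠ ⊤ := measure_closedBall_lt_top.ne
  have hA0 : 0 ≤ A := (by positivity : (0 : ℝ) ≤ cosCoef Ω v 0 ^ 2 + sinCoef Ω v 0 ^ 2).trans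
    (hA 0 (Metric.mem_closedBall_self hR.le))
  have i3 : Integrable ((Metric.closedBall (0 : Space d) R).indicator fun _ => A) :=
    (integrable_indicator_iff measurableSet_closedBall).2 (integrableOn_const hB)
  have e3 : ∫ ξ, (Metric.closedBall (0 : Space d) R).indicator (fun _ => A) ξ
      = volume.real (Metric.closedBall (0 : Space d) R) * A := by
    rw [integral_indicator_const _ measurableSet_closedBall, smul_eq_mul]
  rw [← e1, ← e2, ← e3, ← integral_div, ← integral_add i3 (i2.div_const _)]
  refine integral_mono i1 (i3.add (i2.div_const _)) fun ξ => ?_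
  by_cases hξ : ξ ∈ Metric.closedBall (0 : Space d) R
  · simp only [hξ, Set.indicator_of_mem]
    exact (hA ξ hξ).trans (le_add_of_nonneg_right (by positivity))
  · simp only [hξ, not_false_eq_true, Set.indicator_of_notMem, zero_add]
    rw [Metric.mem_closedBall, dist_zero_right, not_le] at hξ
    rw [le_div_iff₀ (by positivity), mul_comm]
    refine mul_le_mul_of_nonneg_right ?_ (by positivity)
    have h1 : R ^ 2 ≤ ‖ξ‖ ^ 2 := pow_le_pow_left₀ hR.le hξ.le 2
    have h2 : 1 ≤ 4 * Real.pi ^ 2 := by nlinarith [Real.pi_gt_three]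
    nlinarith [sq_nonneg ‖ξ‖]

theorem exists_finite_coef_le (hΩ : MeasurableSet Ω) (hb : Bornology.IsBounded Ω) (R : ℝ) {δ : ℝ}
    (hδ : 0 < δ) :
    ∃ F : Set (Lp ℝ 2 (volume.restrict Ω : Measure (Space d))), F.Finite ∧
      ∀ u, (∀ g ∈ F, inner ℝ g u = 0) → ∀ ξ ∈ Metric.closedBall (0 : Space d) R,
        cosCoef Ω u ξ ^ 2 + sinCoef Ω u ξ ^ 2 ≤ 2 * δ ^ 2 * ‖u‖ ^ 2 := by
  have hfin : volume Ω ≠ ⊤ := hb.measure_lt_top.ne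
  obtain ⟨M, hM0, hM⟩ := hb.exists_pos_norm_le
  have hκ0 : 0 ≤ (volume Ω).toReal ^ (1 / 2 : ℝ) * (2 * Real.pi * M) := by positivity
  obtain ⟨F₁, hF₁, h1⟩ := exists_finite_small_inner hκ0
    (norm_toLp_sub_le hΩ hM0.le hM hfin Real.lipschitzWith_cos (memLp_cos hfin)) R hδ
  obtain ⟨F₂, hF₂, h2⟩ := exists_finite_small_inner hκ0
    (norm_toLp_sub_le hΩ hM0.le hM hfin Real.lipschitzWith_sin (memLp_sin hfin)) R hδ
  refine ⟨F₁ ∪ F₂, hF₁.union hF₂, fun u hu ξ hξ => ?_⟩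
  have a1 := h1 u (fun g hg => hu g (Or.inl hg)) ξ hξ
  have a2 := h2 u (fun g hg => hu g (Or.inr hg)) ξ hξ
  rw [← cosCoef_eq_inner hfin, ← abs_of_nonneg (by positivity : 0 ≤ δ * ‖u‖)] at a1
  rw [← sinCoef_eq_inner hfin, ← abs_of_nonneg (by positivity : 0 ≤ δ * ‖u‖)] at a2
  refine (add_le_add (sq_le_sq.2 a1) (sq_le_sq.2 a2)).trans (le_of_eq ?_)
  ring

theorem exists_finite_norm_fst_le (hΩ : MeasurableSet Ω) (hb : Bornology.IsBounded Ω) {ε : ℝ}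
    (hε : 0 < ε) :
    ∃ F : Set (Lp ℝ 2 (volume.restrict Ω : Measure (Space d))), F.Finite ∧
      ∀ p ∈ energySpace Ω, (∀ g ∈ F, inner ℝ g p.fst = 0) → ‖p.fst‖ ≤ ε * ‖p‖ := by
  have hfin : volume Ω ≠ ⊤ := hb.measure_lt_top.ne
  obtain ⟨R, hR, hRε⟩ : ∃ R : ℝ, 0 < R ∧ 1 / R ^ 2 ≤ ε ^ 2 / 2 := by
    refine ⟨2 / ε, by positivity, ?_⟩
    rw [div_pow, one_div_div]
    nlinarith [sq_nonneg ε]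
  set B := volume.real (Metric.closedBall (0 : Space d) R)
  have hB0 : 0 ≤ B := measureReal_nonneg
  -- Chosen so that the low frequencies contribute at most `ε² / 2` times `‖p.fst‖²`; the radius `R`
  -- does the same for the high ones and the energy.
  set δ := ε / (2 * (B + 1)) with hδ
  have hδ0 : 0 < δ := by positivity
  obtain ⟨F, hF, h1⟩ := exists_finite_coef_le hΩ hb R hδ0
  refine ⟨F, hF, fun p hp hx => ?_⟩
  have hle := (isH10_of_mem_energySpace hp).integral_sq_le hΩ hfin hR (h1 p.fst hx)
  rw [← norm_sq_eq_integral] at hle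
  have hnorm := norm_sq_pairSpace p
  rw [← norm_sq_eq_integral] at hnorm
  have hD0 : 0 ≤ ∫ y in Ω, ‖p.snd y‖ ^ 2 := integral_nonneg fun y => by positivity
  set D := ∫ y in Ω, ‖p.snd y‖ ^ 2
  set U := ‖p.fst‖ ^ 2
  have hBδ : B * (2 * δ ^ 2) ≤ ε ^ 2 / 2 := by
    rw [hδ, div_pow, ← mul_div_assoc, ← mul_div_assoc, div_le_div_iff₀ (by positivity) two_pos]
    have : B * 4 ≤ (2 * (B + 1)) ^ 2 := by nlinarith
    nlinarith [sq_nonneg ε]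
  have hU0 : 0 ≤ U := sq_nonneg _
  have c1 : D / R ^ 2 ≤ ε ^ 2 / 2 * D := by
    rw [div_eq_mul_one_div, mul_comm]
    exact mul_le_mul_of_nonneg_right hRε hD0
  have c2 := mul_le_mul_of_nonneg_right hBδ hU0
  have hfinal : U ≤ (ε * ‖p‖) ^ 2 := by
    rw [mul_pow, hnorm]
    nlinarith [mul_nonneg (sq_nonneg ε) hU0, mul_nonneg (sq_nonneg ε) hD0]
  exact le_of_sq_le_sq hfinal (by positivity)

theorem isCompactOperator_energyEmbedding (hΩ : MeasurableSet Ω) (hb : Bornology.IsBounded Ω) :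
    IsCompactOperator (energyEmbedding Ω) := by
  refine isCompactOperator_of_finite_codim _ fun ε hε => ?_
  obtain ⟨F, hF, h⟩ := exists_finite_norm_fst_le hΩ hb hε
  exact ⟨F, hF, fun x hx => h x x.2 hx⟩

/-! ### Existence of an eigenbasis -/

/-- If `J` is compact and its adjoint is injective, then `J J†` has a Hilbert basis of eigenvectors
with nonzero eigenvalues. -/
theorem exists_hilbertBasis_comp_adjoint.{v, w} {E : Type v} {H : Type w} [NormedAddCommGroup E]
    [InnerProductSpace ℝ E] [CompleteSpace E] [NormedAddCommGroup H] [InnerProductSpace ℝ H]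
    [CompleteSpace H] (J : H →L[ℝ] E) (hJ : IsCompactOperator J)
    (hinj : ∀ f, ContinuousLinearMap.adjoint J f = 0 → f = 0) :
    ∃ (ι : Type v) (b : HilbertBasis ι ℝ E) (μ : ι → ℝ),
      ∀ i, μ i ≠ 0 ∧ J (ContinuousLinearMap.adjoint J (b i)) = μ i • b i := by
  obtain ⟨ι, b, μ, hbμ⟩ := exists_hilbertBasis_eigenvectors
    (T := J ∘L ContinuousLinearMap.adjoint J) (hJ.comp_clm _)
    (fun x y => by
      change inner ℝ (J (ContinuousLinearMap.adjoint J x)) y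
        = inner ℝ x (J (ContinuousLinearMap.adjoint J y))
      rw [← ContinuousLinearMap.adjoint_inner_right, ContinuousLinearMap.adjoint_inner_left])
  refine ⟨ι, b, μ, fun i => ⟨fun h0 => ?_, hbμ i⟩⟩
  have h1 : J (ContinuousLinearMap.adjoint J (b i)) = 0 := by
    have := hbμ i
    rwa [h0, zero_smul] at this
  refine b.orthonormal.ne_zero i (hinj _ ?_)
  rw [← inner_self_eq_zero (𝕜 := ℝ), ContinuousLinearMap.adjoint_inner_left, h1,
    inner_zero_right]

/-- The vector `μ⁻¹ J† b` lifts `b` to the energy space, and the adjoint relation is the weak form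
of the eigenvalue equation. -/
theorem exists_inner_eq_of_adjoint {E H : Type*} [NormedAddCommGroup E]
    [InnerProductSpace ℝ E] [CompleteSpace E] [NormedAddCommGroup H] [InnerProductSpace ℝ H]
    [CompleteSpace H] (J : H →L[ℝ] E) {b : E} {μ : ℝ} (hμ : μ ≠ 0)
    (h : J (ContinuousLinearMap.adjoint J b) = μ • b) :
    ∃ w : H, J w = b ∧ ∀ q, inner ℝ w q = μ⁻¹ * inner ℝ b (J q) := by
  refine ⟨μ⁻¹ • ContinuousLinearMap.adjoint J b, ?_, fun q => ?_⟩
  · rw [map_smul, h, inv_smul_smul₀ hμ]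
  · rw [real_inner_smul_left, ContinuousLinearMap.adjoint_inner_left]

theorem exists_reindex_hilbertBasis {E ι κ : Type*} [NormedAddCommGroup E]
    [InnerProductSpace ℝ E] [CompleteSpace E] (b : HilbertBasis ι ℝ E) (e : κ ≃ ι) :
    ∃ B : HilbertBasis κ ℝ E, ⇑B = b ∘ e := by
  refine ⟨_, HilbertBasis.coe_mkOfOrthogonalEqBot (b.orthonormal.comp e e.injective) ?_⟩
  rw [Set.range_comp, e.surjective.range_eq, Set.image_univ,
    ← Submodule.topologicalClosure_eq_top_iff]
  exact b.dense_span

/-- The range of the embedding contains all test functions, so a function killed by the adjoint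
integrates to zero against each of them. -/
theorem eq_zero_of_adjoint_energyEmbedding_eq_zero (hΩ : IsOpen Ω) (hfin : volume Ω ≠ ⊤)
    {f : Lp ℝ 2 (volume.restrict Ω : Measure (Space d))}
    (hf : ContinuousLinearMap.adjoint (energyEmbedding Ω) f = 0) : f = 0 := by
  have h0 : ∀ g : Space d → ℝ, ContDiff ℝ ∞ g → HasCompactSupport g → tsupport g ⊆ Ω →
      ∫ x, g x • f x = 0 := by
    intro g hg hgc hgΩ
    have hφ : IsTestFunction Ω g := ⟨hg, hgc, hgΩ⟩
    have h1 : inner ℝ f (energyEmbedding Ω ⟨_, hφ.isH10.mem_energySpace⟩) = 0 := by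
      rw [← ContinuousLinearMap.adjoint_inner_left, hf, inner_zero_left]
    have h2 : inner ℝ f (hφ.isH10.memLp.toLp g) = 0 := h1
    have h3 := inner_toLp_toLp (Lp.memLp f) hφ.isH10.memLp
    rw [Lp.toLp_coeFn, h2] at h3
    rw [← setIntegral_eq_integral_of_forall_compl_eq_zero
      (fun x hx => by rw [hφ.eq_zero hx, zero_smul]), h3]
    rfl
  have := hΩ.ae_eq_zero_of_integral_contDiff_smul_eq_zero
    (integrableOn_of_memLp hfin (Lp.memLp f)).locallyIntegrableOn h0
  rw [Lp.eq_zero_iff_ae_eq_zero]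
  exact (ae_restrict_iff' hΩ.measurableSet).2 this

/-- The energy space carries the full `H¹` inner product. Subtracting its `L²` part shifts `μ⁻¹` to
the eigenvalue `μ⁻¹ - 1`. -/
theorem dirichletLaplacianEq_of_inner {b : Lp ℝ 2 (volume.restrict Ω : Measure (Space d))} {μ : ℝ}
    (w : energySpace Ω) (hwb : energyEmbedding Ω w = b)
    (hw : ∀ q, inner ℝ w q = μ⁻¹ * inner ℝ b (energyEmbedding Ω q)) :
    DirichletLaplacianEq Ω (fun x => b x) (fun x => (μ⁻¹ - 1) * b x) := by
  obtain ⟨p, hp⟩ := w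
  have hwb' : p.fst = b := hwb
  refine ⟨(Lp.memLp b).const_mul _, fun x => p.snd x, ?_, fun v K hv => ?_⟩
  · have := isH10_of_mem_energySpace hp
    rwa [hwb'] at this
  · have e1 := hw ⟨_, hv.mem_energySpace⟩
    have e2 : inner ℝ p (WithLp.toLp 2 (hv.memLp.toLp v, hv.memLp_grad.toLp K))
        = inner ℝ p.fst (hv.memLp.toLp v) + inner ℝ p.snd (hv.memLp_grad.toLp K) :=
      WithLp.prod_inner_apply _ _
    have e1' : inner ℝ p (WithLp.toLp 2 (hv.memLp.toLp v, hv.memLp_grad.toLp K))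
        = μ⁻¹ * inner ℝ b (hv.memLp.toLp v) := e1
    have e3 := inner_toLp_toLp (Lp.memLp p.snd) hv.memLp_grad
    have e4 := inner_toLp_toLp (Lp.memLp b) hv.memLp
    rw [Lp.toLp_coeFn] at e3 e4
    have e5 : ∫ x in Ω, (μ⁻¹ - 1) * b x * v x = (μ⁻¹ - 1) * inner ℝ b (hv.memLp.toLp v) := by
      rw [e4, ← integral_const_mul]
      refine integral_congr_ae (ae_of_all _ fun x => ?_)
      simp only [RCLike.inner_apply, conj_trivial]
      ring
    rw [← e3, e5]
    rw [hwb'] at e2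
    linarith

/-- With finitely many eigenvalues the heat trace would be at most their number, whereas its lower
bound grows like `|Ω|/(4πt)^{d/2}` as `t → 0`. -/
theorem infinite_of_eigenbasis (hd : d ≠ 0) (hΩ : IsOpen Ω) (hb : Bornology.IsBounded Ω)
    (hne : Ω.Nonempty) (hne' : Ωᶜ.Nonempty) {ι : Type*} {lam : ι → ℝ}
    {u : HilbertBasis ι ℝ (Lp ℝ 2 (volume.restrict Ω : Measure (Space d)))}
    (hu : ∀ j, DirichletLaplacianEq Ω (fun x => u j x) (fun x => lam j * u j x)) :
    Infinite ι := by
  by_contra hfin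
  rw [not_infinite_iff_finite] at hfin
  have := Fintype.ofFinite ι
  have hvol : volume Ω ≠ ⊤ := hb.measure_lt_top.ne
  have hbound : ∀ t : ℝ, 0 < t → volume.real Ω - 2 * volume.real (tube Ω (√t))
      ≤ Fintype.card ι * (4 * Real.pi * t) ^ ((d : ℝ) / 2) := by
    intro t ht
    have h1 := heatTrace_lower_bound_tube hΩ hb hne' hu ht
    rw [div_le_iff₀ (by positivity), tsum_fintype] at h1
    refine h1.trans (mul_le_mul_of_nonneg_right ?_ (by positivity))
    refine (Finset.sum_le_card_nsmul _ _ 1 fun j _ => ?_).trans (by simp)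
    rw [Real.exp_le_one_iff]
    nlinarith [eigenvalue_nonneg hu j]
  have htube : tube Ω 0 = ∅ := by
    rw [Set.eq_empty_iff_forall_notMem]
    rintro x ⟨hx, hx0⟩
    -- Needed because the distance to the empty set is zero by convention.
    have hfr : (frontier Ω).Nonempty :=
      nonempty_frontier_iff.2 ⟨hne, fun h => by simp [h] at hne'⟩
    have h1 : x ∈ frontier Ω := by
      rw [isClosed_frontier.mem_iff_infDist_zero hfr]
      exact le_antisymm hx0 Metric.infDist_nonneg
    exact h1.2 (by rwa [hΩ.interior_eq])
  have hsqrt : Tendsto (fun t : ℝ => √t) (𝓝[>] 0) (𝓝[>] 0) := by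
    refine tendsto_nhdsWithin_iff.2 ⟨?_, ?_⟩
    · have := (Real.continuous_sqrt.tendsto 0).mono_left (nhdsWithin_le_nhds (s := Set.Ioi 0))
      simpa using this
    · filter_upwards [self_mem_nhdsWithin] with t ht using Real.sqrt_pos.2 ht
  have l1 : Tendsto (fun t : ℝ => volume.real Ω - 2 * volume.real (tube Ω (√t))) (𝓝[>] 0)
      (𝓝 (volume.real Ω)) := by
    have := ((tendsto_measureReal_tube hΩ hvol 0).comp hsqrt).const_mul 2 |>.const_sub
      (volume.real Ω)
    simpa [htube] using this
  have l2 : Tendsto (fun t : ℝ => Fintype.card ι * (4 * Real.pi * t) ^ ((d : ℝ) / 2)) (𝓝[>] 0)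
      (𝓝 0) := by
    have hpos : 0 < (d : ℝ) / 2 := by positivity
    have hc : Continuous fun t : ℝ => Fintype.card ι * (4 * Real.pi * t) ^ ((d : ℝ) / 2) :=
      continuous_const.mul ((continuous_const.mul continuous_id).rpow_const fun _ => Or.inr hpos.le)
    have := (hc.tendsto 0).mono_left (nhdsWithin_le_nhds (s := Set.Ioi 0))
    simpa [Real.zero_rpow hpos.ne'] using this
  have hle := le_of_tendsto_of_tendsto l1 l2 (by
    filter_upwards [self_mem_nhdsWithin] with t ht using hbound t ht)
  have hpos : 0 < volume.real Ω := ENNReal.toReal_pos (hΩ.measure_pos volume hne).ne' hvol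
  linarith

theorem exists_eigenbasis (hd : d ≠ 0) (hΩ : IsOpen Ω) (hb : Bornology.IsBounded Ω)
    (hne : Ω.Nonempty) (hne' : Ωᶜ.Nonempty) :
    ∃ (lam : ℕ → ℝ) (u : HilbertBasis ℕ ℝ (Lp ℝ 2 (volume.restrict Ω : Measure (Space d)))),
      IsDirichletEigenbasis Ω lam u := by
  obtain ⟨ι, b, μ, hbμ⟩ := exists_hilbertBasis_comp_adjoint (energyEmbedding Ω)
    (isCompactOperator_energyEmbedding hΩ.measurableSet hb)
    fun f => eq_zero_of_adjoint_energyEmbedding_eq_zero hΩ hb.measure_lt_top.ne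
  have hu : ∀ i, DirichletLaplacianEq Ω (fun x => b i x) (fun x => ((μ i)⁻¹ - 1) * b i x) := by
    intro i
    obtain ⟨w, hw1, hw2⟩ := exists_inner_eq_of_adjoint _ (hbμ i).1 (hbμ i).2
    exact dirichletLaplacianEq_of_inner w hw1 hw2
  have : Fact ((2 : ℝ≥0∞) ≠ ⊤) := ⟨by norm_num⟩
  have : Countable ι := countable_of_orthonormal b.orthonormal
  have : Infinite ι := infinite_of_eigenbasis hd hΩ hb hne hne' hu
  obtain ⟨e⟩ := nonempty_equiv_of_countable (α := ℕ) (β := ι)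
  obtain ⟨B, hB⟩ := exists_reindex_hilbertBasis b e
  refine ⟨fun j => (μ (e j))⁻¹ - 1, B, fun j => ?_⟩
  rw [hB]
  exact hu (e j)

/-! ### The remainder -/

theorem ClassS.remainder_isLittleO (h : ClassS Ω) :
    (fun t : ℝ => remainder Ω t) =o[𝓝[>] 0] (fun t : ℝ => t ^ ((1 - (d : ℝ)) / 2)) := by
  have hsqrt : Tendsto (fun t : ℝ => t ^ (1 / 2 : ℝ)) (𝓝[>] 0) (𝓝[>] 0) := by
    refine tendsto_nhdsWithin_iff.2 ⟨?_, ?_⟩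
    · have := (Real.continuous_sqrt.tendsto 0).mono_left (nhdsWithin_le_nhds (s := Set.Ioi 0))
      simp_rw [← Real.sqrt_eq_rpow]
      simpa using this
    · filter_upwards [self_mem_nhdsWithin] with t ht using Real.rpow_pos_of_pos ht _
  -- The quotient of the remainder by `t^{(1-d)/2}` is a constant times `|∂Ω| - |ω_{√t}|/√t`, which
  -- tends to zero.
  have l1 := ((h.tendsto.comp hsqrt).const_sub (boundaryMeasure Ω)).const_mul
    (2 * ((4 * Real.pi) ^ ((d : ℝ) / 2))⁻¹)
  rw [sub_self, mul_zero] at l1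
  refine isLittleO_iff_exists_eq_mul.2 ⟨_, l1, ?_⟩
  filter_upwards [self_mem_nhdsWithin] with t ht
  have ht0 : (0 : ℝ) < t := ht
  have hs : 0 < t ^ (1 / 2 : ℝ) := Real.rpow_pos_of_pos ht0 _
  have e : t ^ ((1 - (d : ℝ)) / 2) = t ^ (1 / 2 : ℝ) / t ^ ((d : ℝ) / 2) := by
    rw [← Real.rpow_sub ht0]
    congr 1
    ring
  simp only [remainder, Pi.mul_apply, Function.comp_apply]
  rw [e, Real.mul_rpow (by positivity) ht0.le]
  have h1 : (4 * Real.pi) ^ ((d : ℝ) / 2) ≠ 0 := by positivity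
  have h2 : t ^ ((d : ℝ) / 2) ≠ 0 := by positivity
  field_simp

end DirichletHeat

/-! ### Conclusion -/

theorem mainTheorem10 (d : ℕ) (hd : 2 ≤ d) (Ω : Set (DirichletHeat.Space d))
    (hΩ : DirichletHeat.ClassS Ω) :
    (∃ (lam : ℕ → ℝ)
        (u : HilbertBasis ℕ ℝ
          (Lp ℝ 2 (volume.restrict Ω : Measure (DirichletHeat.Space d)))),
        DirichletHeat.IsDirichletEigenbasis Ω lam u) ∧
    (∀ (lam : ℕ → ℝ)
        (u : HilbertBasis ℕ ℝ
          (Lp ℝ 2 (volume.restrict Ω : Measure (DirichletHeat.Space d)))),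
        DirichletHeat.IsDirichletEigenbasis Ω lam u →
        ∀ t : ℝ, 0 < t → t ≤ DirichletHeat.inradius Ω ^ 2 →
          Summable (fun j : ℕ => Real.exp (-lam j * t)) ∧
          ∑' j : ℕ, Real.exp (-lam j * t) ≥
            volume.real Ω / (4 * Real.pi * t) ^ ((d : ℝ) / 2)
              - 2 * (DirichletHeat.boundaryMeasure Ω * t ^ (1 / 2 : ℝ) /
                  (4 * Real.pi * t) ^ ((d : ℝ) / 2))
              + DirichletHeat.remainder Ω t) ∧
    (fun t : ℝ => DirichletHeat.remainder Ω t) =o[𝓝[>] 0]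
      (fun t : ℝ => t ^ ((1 - (d : ℝ)) / 2)) := by
  have hd0 : d ≠ 0 := by omega
  have : Nontrivial (DirichletHeat.Space d) := by
    have : Nonempty (Fin d) := ⟨⟨0, by omega⟩⟩
    infer_instance
  have hne' : Ωᶜ.Nonempty := by
    rw [Set.nonempty_compl]
    rintro rfl
    exact NormedSpace.unbounded_univ ℝ (DirichletHeat.Space d) hΩ.bounded
  refine ⟨DirichletHeat.exists_eigenbasis hd0 hΩ.isOpen hΩ.bounded hΩ.nonempty hne', ?_,
    hΩ.remainder_isLittleO⟩
  intro lam u hu t ht _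
  refine ⟨DirichletHeat.summable_exp_eigenvalue hΩ.isOpen.measurableSet
    hΩ.bounded.measure_lt_top.ne hu ht, ?_⟩
  have h := DirichletHeat.heatTrace_lower_bound_tube hΩ.isOpen hΩ.bounded hne' hu ht
  -- The boundary term cancels against the one in the remainder, which leaves `|Ω| - 2|ω_{√t}|` in
  -- the numerator.
  refine le_trans (le_of_eq ?_) h
  rw [DirichletHeat.remainder, ← Real.sqrt_eq_rpow]
  ring
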